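/- Let $(\mathcal S,\mathcal A,P,\gamma,r)$ be a Markov decision process with finite state set $\mathcal S$, finite action set $\mathcal A$, transition kernel $P(s'|s,a)$, discount factor $\gamma\in[0,1)$ and reward $r\in\mathbb R^{\mathcal S\times\mathcal A}$, and let $\mu\in\Delta_{\mathcal S}$ be an initial distribution. Policies are the elements $\pi=(\pi(\cdot|s))_{s}$ of $\Delta_{\mathcal A}^{\mathcal S}$; we write $\pi_s=\pi(\cdot|s)$. For $S_0\sim\mu$, $A_t\sim\pi(\cdot|S_t)$, $S_{t+1}\sim P(\cdot|S_t,A_t)$ put $$R(\pi)=(1-\gamma)\,\mathbb E\Big[\sum_{t\ge0}\gamma^t r(S_t,A_t)\Big],\qquad d^\pi(s)=(1-\gamma)\sum_{t\ge 0}\gamma^t\,\mathbb P(S_t=s),$$ $R^\star=\sup_{\pi\in\Delta_{\mathcal A}^{\mathcal S}}R(\pi)$ and $\Pi^\star=\{\pi\in\Delta_{\mathcal A}^{\mathcal S}:R(\pi)=R^\star\}$. Assume that $d^\pi(s)>0$ for all $s\in\mathcal S$ and all $\pi$ in the relative interior $\operatorname{int}(\Delta_{\mathcal A}^{\mathcal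 S})$. Let $\psi:\Delta_{\mathcal A}\to\mathbb R$ be strictly convex, and twice continuously differentiable on $\operatorname{int}(\Delta_{\mathcal A})$ with $v^\top\nabla^2\psi(p)v>0$ for all $p\in\operatorname{int}(\Delta_{\mathcal A})$ and all $v\ne0$ in the tangent space $T\Delta_{\mathcal A}=\{v:\sum_a v(a)=0\}$. Let $D_\psi(p,q)=\psi(p)-\psi(q)-\nabla\psi(q)^\top(p-q)$ be its Bregman divergence and put $$D_\Psi(\pi_1,\pi_2)=\sum_{s}d^{\pi_1}(s)\,D_\psi(\pi_{1,s},\pi_{2,s}),\qquad g^\psi_\pi(u,w)=\sum_s d^\pi(s)\,u_s^\top\nabla^2\psi(\pi_s)\,w_s .$$ Let $\nabla^\psi R(\pi)$ be the gradient of $R$ at $\pi\in\operatorname{int}(\Delta_{\mathcal A}^{\mathcal S})$ with respect to the Riemannian metric $g^\psi$. Fix $\pi_0\in\operatorname{int}(\Delta_{\mathcal A}^{\mathcal S})$. A solution of the $\psi$ gradient flow on $[0,T)$, $T\in(0,\infty]$, is a differentiable curve $(\pi_t)_{t\in[0,T)}$ in $\operatorname{int}(\Delta_{\mathcal A}^{\mathcal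 S})$ that starts at $\pi_0$ and satisfies $\partial_t\pi_t=\nabla^\psi R(\pi_t)$ for all $t\in[0,T)$. Then the following hold. 1. (Well-posedness) There is a solution on $[0,T)$ for some $T>0$, and any two solutions agree on the intersection of their time intervals. 2. (Central path) If $(\pi_t)$ is a solution on $[0,T)$, then for every $t\in(0,T)$ the policy $\pi_t$ is the unique maximizer of $R(\pi)-t^{-1}D_\Psi(\pi,\pi_0)$ over $\pi\in\Delta_{\mathcal A}^{\mathcal S}$. 3. (Sublinear convergence) The supremum $R^\star$ is attained, and if $(\pi_t)$ is a solution on $[0,T)$, then for every $t\in(0,T)$ $$0\le R^\star-R(\pi_t)\le\frac{\inf_{\pi^\star\in\Pi^\star}D_\Psi(\pi^\star,\pi_0)-D_\Psi(\pi_t,\pi_0)}{t}\le\frac{\inf_{\pi^\star\in\Pi^\star}D_\Psi(\pi^\star,\pi_0)}{t}.$$ If $\psi$ is continuous on $\Delta_{\mathcal A}$, the infimum is a minimum. 4. (Implicit bias) If $\psi$ is continuous on $\Delta_{\mathcal A}$ and $(\pi_t)_{t\ge0}$ is a global solution, that is $T=\infty$, then $\pi_t$ converges for $t\to\infty$ to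 a policy $$\pi^\star\in\operatorname*{arg\,min}_{\pi\in\Pi^\star}D_\Psi(\pi,\pi_0).$$ Every other minimizer $\pi$ satisfies $\pi(\cdot|s)=\pi^\star(\cdot|s)$ for all $s$ with $d^{\pi^\star}(s)>0$; in particular $\pi^\star$ is the unique minimizer if $d^{\pi^\star}(s)>0$ for all $s\in\mathcal S$. -/

import Mathlib

open Set Filter Topology MeasureTheory

noncomputable section

/-- A finite discounted Markov decision process with state set `S` and action set `A`, including
the instantaneous reward and the initial distribution. -/
structure FiniteMDP (S A : Type*) [Fintype S] [Fintype A] where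
  /-- `P s a s'` is the probability of moving from `s` to `s'` under the action `a`. -/
  P : S → A → S → ℝ
  P_mem : ∀ s a, P s a ∈ stdSimplex ℝ S
  /-- the discount factor -/
  γ : ℝ
  γ_nonneg : 0 ≤ γ
  γ_lt_one : γ < 1
  /-- the instantaneous reward -/
  r : S → A → ℝ
  /-- the initial distribution -/
  μ : S → ℝ
  μ_mem : μ ∈ stdSimplex ℝ S

/-- The relative interior of the probability simplex. -/
def simplexInt (A : Type*) [Fintype A] : Set (A → ℝ) :=
  {p | (∀ a, 0 < p a) ∧ ∑ a, p a = 1}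

/-- The tangent space of the probability simplex. -/
def simplexTangent (A : Type*) [Fintype A] : Set (A → ℝ) :=
  {v | ∑ a, v a = 0}

/-- The policies; `π s a` is the probability `π(a|s)`. -/
def policies (S A : Type*) [Fintype A] : Set (S → A → ℝ) :=
  {π | ∀ s, π s ∈ stdSimplex ℝ A}

/-- The relative interior of the polytope of policies. -/
def policiesInt (S A : Type*) [Fintype A] : Set (S → A → ℝ) :=
  {π | ∀ s, π s ∈ simplexInt A}

/-- The tangent space of the polytope of policies. -/
def policyTangent (S A : Type*) [Fintype A] : Set (S → A → ℝ) :=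
  {v | ∀ s, v s ∈ simplexTangent A}

section Regularizer

variable {A : Type*} [Fintype A]

/-- The Bregman divergence `ψ(p) - ψ(q) - ∇ψ(q)ᵀ(p - q)`. For `p` in the simplex and `q` in its
relative interior the derivative is one along the simplex. -/
def bregman (ψ : (A → ℝ) → ℝ) (p q : A → ℝ) : ℝ :=
  ψ p - ψ q - lineDeriv ℝ ψ q (p - q)

/-- The Hessian form `uᵀ ∇²ψ(p) w`. It is used for `p` in the relative interior of the simplex and
for tangent vectors `u`, `w`, where it depends on the values of `ψ` on the simplex only. -/
def hessForm (ψ : (A → ℝ) → ℝ) (p u w : A → ℝ) : ℝ :=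
  lineDeriv ℝ (fun q => lineDeriv ℝ ψ q u) p w

/-- A strictly convex function on the simplex, twice continuously differentiable in the relative
interior with a Hessian that is positive definite on the tangent space. The values of `ψ` outside
the simplex are irrelevant. -/
structure IsRegularizer (ψ : (A → ℝ) → ℝ) : Prop where
  strictConvexOn : StrictConvexOn ℝ (stdSimplex ℝ A) ψ
  contDiffOn : ContDiffOn ℝ 2 ψ (simplexInt A)
  hess_pos : ∀ p ∈ simplexInt A, ∀ v ∈ simplexTangent A, v ≠ 0 → 0 < hessForm ψ p v v

end Regularizer

namespace FiniteMDP

variable {S A : Type*} [Fintype S] [Fintype A]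

/-- `M.stateLaw π t s` is the probability of `S_t = s` when `S_0 ∼ μ`, `A_t ∼ π(·|S_t)` and
`S_{t+1} ∼ P(·|S_t, A_t)`. -/
def stateLaw (M : FiniteMDP S A) (π : S → A → ℝ) : ℕ → S → ℝ
  | 0 => M.μ
  | t + 1 => fun s' => ∑ s, ∑ a, stateLaw M π t s * π s a * M.P s a s'

/-- The discounted state distribution `d^π(s) = (1 - γ) ∑ₜ γᵗ ℙ(S_t = s)`. -/
def stateDist (M : FiniteMDP S A) (π : S → A → ℝ) (s : S) : ℝ :=
  (1 - M.γ) * ∑' t : ℕ, M.γ ^ t * M.stateLaw π t s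

/-- The reward `R(π) = (1 - γ) 𝔼[∑ₜ γᵗ r(S_t, A_t)]`, where the expectation of `r(S_t, A_t)` is
written out through the law of `(S_t, A_t)`; see `reward_eq_expectation`. -/
def reward (M : FiniteMDP S A) (π : S → A → ℝ) : ℝ :=
  (1 - M.γ) * ∑' t : ℕ, M.γ ^ t * ∑ s, ∑ a, M.stateLaw π t s * π s a * M.r s a

/-- The optimal reward `R⋆`. -/
def optReward (M : FiniteMDP S A) : ℝ :=
  sSup (M.reward '' policies S A)

/-- The set `Π⋆` of optimal policies. -/
def optPolicies (M : FiniteMDP S A) : Set (S → A → ℝ) :=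
  {π ∈ policies S A | M.reward π = M.optReward}

/-- State exploration: every policy in the relative interior visits every state. -/
def Exploration (M : FiniteMDP S A) : Prop :=
  ∀ π ∈ policiesInt S A, ∀ s, 0 < M.stateDist π s

/-- The divergence `D_Ψ(π₁, π₂) = ∑ₛ d^{π₁}(s) D_ψ(π₁(·|s), π₂(·|s))`. -/
def policyDiv (M : FiniteMDP S A) (ψ : (A → ℝ) → ℝ) (π₁ π₂ : S → A → ℝ) : ℝ :=
  ∑ s, M.stateDist π₁ s * bregman ψ (π₁ s) (π₂ s)

/-- The metric `g^ψ_π(u, w) = ∑ₛ d^π(s) uₛᵀ ∇²ψ(πₛ) wₛ` on the interior of the policy polytope. -/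
def policyMetric (M : FiniteMDP S A) (ψ : (A → ℝ) → ℝ) (π u w : S → A → ℝ) : ℝ :=
  ∑ s, M.stateDist π s * hessForm ψ (π s) (u s) (w s)

/-- `v` is the Riemannian gradient at `π` of the reward with respect to the metric `g^ψ`: it is the
tangent vector with `g^ψ_π(v, w) = dR(π) w` for all tangent vectors `w`. -/
def IsGradient (M : FiniteMDP S A) (ψ : (A → ℝ) → ℝ) (π v : S → A → ℝ) : Prop :=
  v ∈ policyTangent S A ∧
    ∀ w ∈ policyTangent S A, HasLineDerivAt ℝ M.reward (M.policyMetric ψ π v w) π w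

end FiniteMDP

/-- The time interval `[0, T)` for `T` real or infinite. -/
def timeInterval (T : EReal) : Set ℝ :=
  {t | 0 ≤ t ∧ (t : EReal) < T}

namespace FiniteMDP

variable {S A : Type*} [Fintype S] [Fintype A]

/-- `(π t)` for `t` in `[0, T)` is a solution in the interior of the policy polytope of the
gradient flow `∂ₜ πₜ = ∇^ψ R(πₜ)` that starts at `π₀`. -/
structure IsFlow (M : FiniteMDP S A) (ψ : (A → ℝ) → ℝ) (π₀ : S → A → ℝ) (T : EReal)
    (π : ℝ → S → A → ℝ) : Prop where
  init : π 0 = π₀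
  mem : ∀ t ∈ timeInterval T, π t ∈ policiesInt S A
  eqn : ∀ t ∈ timeInterval T, ∃ v, M.IsGradient ψ (π t) v ∧
    HasDerivWithinAt π v (timeInterval T) t

section Realization

variable {Ω : Type*} [MeasurableSpace Ω]

/-- `stateLaw` is the law of the states of every process with the prescribed dynamics. -/
theorem stateLaw_eq_prob (M : FiniteMDP S A) (π : S → A → ℝ)
    (ℙ : Measure Ω) [IsProbabilityMeasure ℙ] (X : ℕ → Ω → S) (Y : ℕ → Ω → A)
    (hX : ∀ t s, MeasurableSet {ω | X t ω = s}) (hY : ∀ t a, MeasurableSet {ω | Y t ω = a})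
    (h0 : ∀ s, ℙ.real {ω | X 0 ω = s} = M.μ s)
    (hπ : ∀ t s a, ℙ.real {ω | X t ω = s ∧ Y t ω = a} = ℙ.real {ω | X t ω = s} * π s a)
    (hP : ∀ t s a s', ℙ.real {ω | (X t ω = s ∧ Y t ω = a) ∧ X (t + 1) ω = s'} =
      ℙ.real {ω | X t ω = s ∧ Y t ω = a} * M.P s a s') (t : ℕ) (s : S) :
    ℙ.real {ω | X t ω = s} = M.stateLaw π t s := by
  induction t generalizing s with
  | zero => exact h0 s
  | succ t ih =>
    have hset : {ω | X (t + 1) ω = s} = ⋃ p ∈ (Finset.univ : Finset (S × A)),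
        {ω | (X t ω = p.1 ∧ Y t ω = p.2) ∧ X (t + 1) ω = s} := by
      ext ω
      simp
    rw [hset, measureReal_biUnion_finset]
    · simp only [hP, hπ, ih, stateLaw, Fintype.sum_prod_type]
    · intro p _ q _ hpq
      refine Set.disjoint_left.2 fun ω h1 h2 => hpq ?_
      simp only [mem_setOf_eq] at h1 h2
      exact Prod.ext (h1.1.1.symm.trans h2.1.1) (h1.1.2.symm.trans h2.1.2)
    · intro p _
      exact ((hX t p.1).inter (hY t p.2)).inter (hX (t + 1) s)

/-- `reward` is the expected discounted reward of every process with the prescribed dynamics. -/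
theorem reward_eq_expectation (M : FiniteMDP S A) (π : S → A → ℝ)
    (ℙ : Measure Ω) [IsProbabilityMeasure ℙ] (X : ℕ → Ω → S) (Y : ℕ → Ω → A)
    (hX : ∀ t s, MeasurableSet {ω | X t ω = s}) (hY : ∀ t a, MeasurableSet {ω | Y t ω = a})
    (h0 : ∀ s, ℙ.real {ω | X 0 ω = s} = M.μ s)
    (hπ : ∀ t s a, ℙ.real {ω | X t ω = s ∧ Y t ω = a} = ℙ.real {ω | X t ω = s} * π s a)
    (hP : ∀ t s a s', ℙ.real {ω | (X t ω = s ∧ Y t ω = a) ∧ X (t + 1) ω = s'} =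
      ℙ.real {ω | X t ω = s ∧ Y t ω = a} * M.P s a s') :
    M.reward π = (1 - M.γ) * ∫ ω, ∑' t : ℕ, M.γ ^ t * M.r (X t ω) (Y t ω) ∂ℙ := by
  classical
  have hmeas : ∀ t s a, MeasurableSet {ω | X t ω = s ∧ Y t ω = a} := fun t s a =>
    (hX t s).inter (hY t a)
  have hexp : ∀ f : S → A → ℝ, ∀ t, (fun ω => f (X t ω) (Y t ω)) =
      fun ω => ∑ s, ∑ a, indicator {ω | X t ω = s ∧ Y t ω = a} (fun _ => f s a) ω := by
    intro f t
    funext ω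
    simp only [indicator, mem_setOf_eq]
    rw [Finset.sum_eq_single (X t ω), Finset.sum_eq_single (Y t ω)]
    · simp
    · intro a _ ha
      simp [ha.symm]
    · simp
    · intro s _ hs
      simp [hs.symm]
    · simp
  have hint : ∀ f : S → A → ℝ, ∀ t s a,
      Integrable (indicator {ω | X t ω = s ∧ Y t ω = a} (fun _ => f s a)) ℙ := fun f t s a =>
    (integrable_const _).indicator (hmeas t s a)
  have hint' : ∀ f : S → A → ℝ, ∀ t, Integrable (fun ω => f (X t ω) (Y t ω)) ℙ := by
    intro f t
    rw [hexp f t]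
    exact integrable_finsetSum _ fun s _ => integrable_finsetSum _ fun a _ => hint f t s a
  have hval : ∀ t, ∫ ω, M.r (X t ω) (Y t ω) ∂ℙ =
      ∑ s, ∑ a, M.stateLaw π t s * π s a * M.r s a := by
    intro t
    rw [hexp M.r t, integral_finsetSum _ fun s _ => integrable_finsetSum _ fun a _ => hint M.r t s a]
    refine Finset.sum_congr rfl fun s _ => ?_
    rw [integral_finsetSum _ fun a _ => hint M.r t s a]
    refine Finset.sum_congr rfl fun a _ => ?_
    rw [integral_indicator (hmeas t s a), setIntegral_const, hπ,
      stateLaw_eq_prob M π ℙ X Y hX hY h0 hπ hP, smul_eq_mul]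
  have hbound : ∀ s a, ‖M.r s a‖ ≤ ∑ s, ∑ a, ‖M.r s a‖ := fun s a =>
    (Finset.single_le_sum (f := fun a => ‖M.r s a‖) (fun _ _ => norm_nonneg _)
      (Finset.mem_univ a)).trans
      (Finset.single_le_sum (f := fun s => ∑ a, ‖M.r s a‖)
        (fun _ _ => Finset.sum_nonneg fun _ _ => norm_nonneg _) (Finset.mem_univ s))
  unfold reward
  congr 1
  rw [← integral_tsum_of_summable_integral_norm]
  · refine tsum_congr fun t => ?_
    rw [integral_const_mul, hval]
  · intro t
    exact (hint' M.r t).const_mul _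
  · refine Summable.of_nonneg_of_le (fun t => integral_nonneg fun _ => norm_nonneg _) (fun t => ?_)
      ((summable_geometric_of_lt_one M.γ_nonneg M.γ_lt_one).mul_right (∑ s, ∑ a, ‖M.r s a‖))
    have h := integral_mono (μ := ℙ) ((hint' M.r t).const_mul (M.γ ^ t)).norm
      (integrable_const (M.γ ^ t * ∑ s, ∑ a, ‖M.r s a‖)) (fun ω => by
        simp only [norm_mul, norm_pow, Real.norm_of_nonneg M.γ_nonneg]
        exact mul_le_mul_of_nonneg_left (hbound _ _) (pow_nonneg M.γ_nonneg t))
    simpa using h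

end Realization

end FiniteMDP

end

/-!
The gradient flow decouples over the states. The performance difference lemma `reward_sub_reward`
writes `R(q) - R(π)` as the average of `⟨q_s - π_s, Q^π_s⟩` with the weights `d^q(s)`, where `Q^π` are
the action values; hence the derivative of `R` at `π` in the direction `w` averages `⟨w_s, Q^π_s⟩` with
the weights `d^π(s)`. The metric carries the same weights, so that they cancel: the flow is
`∇²ψ(π_s) ∂ₜπ_s = Q^π_s` on the tangent space (`isGradient_iff`).

For a fixed policy `q`, differentiating the Bregman divergences and applying the performance
difference lemma once more gives `∂ₜ D(q, πₜ) = -(R(q) - R(πₜ))`. The part that depends on `q` is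
constant in time, and therefore `t R(q) - D(q, π₀) + D(q, πₜ)` does not depend on `q`
(`IsFlow.regularized_reward_eq`). As `D(q, πₜ) ≥ 0` vanishes for `q = πₜ` only, this is the central
path property; it implies the uniqueness of solutions and, by inserting optimal policies for `q`,
the convergence rate. The divergence `D(q, p)` is definite although it ignores the states that `q`
does not visit: by the balance equation, a policy that agrees with `p` on the states that it visits
has the same state distribution as `p` (`stateDist_eq_of_eq_on_support`).

Existence is not immediate from the Picard–Lindelöf theorem since the gradient is merely continuous
for a `C²` regularizer. In the dual coordinates `∇ψ(π_s)` the flow becomes `∂ₜθ = Q^{π(θ)}`, modulo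
constants in every state, and this vector field is `C¹` by the inverse function theorem.

For the implicit bias, the reduced form of the flow shows that it does not depend on the initial
distribution. Under the uniform initial distribution every policy visits every state, the divergence
to an optimal policy decreases along the flow, and for a cluster point it tends to zero because
`D_ψ(p, q) → 0` for `q → p` on a simplex (`IsRegularizer.tendsto_bregman_zero`). This gives
convergence in every state. For the original initial distribution, `D(p, πₜ) - D(p, π₀)` is the
same for all optimal `p`; comparing with the limit shows that the limit minimizes `D(·, π₀)` and
that for every other minimizer `p` also `D(p, πₜ) → 0`.
-/

/-! ### Regularizers on the simplex and their Bregman divergence -/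

section Regularizer

variable {A : Type*} [Fintype A]

theorem simplexInt_subset_stdSimplex : simplexInt A ⊆ stdSimplex ℝ A :=
  fun _ hp => ⟨fun a => (hp.1 a).le, hp.2⟩

theorem sub_mem_simplexTangent {p q : A → ℝ} (hp : ∑ a, p a = 1) (hq : ∑ a, q a = 1) :
    p - q ∈ simplexTangent A := by
  simp [simplexTangent, hp, hq]

/-- The orthogonal projection onto the affine hyperplane spanned by the simplex. -/
noncomputable def simplexProj (x : A → ℝ) : A → ℝ :=
  fun a => x a - (∑ b, x b - 1) / Fintype.card A

/-- An extension of `ψ` from the hyperplane spanned by the simplex to the whole space. The quadratic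
term makes the Hessian nondegenerate in the directions transversal to the hyperplane. -/
noncomputable def regExt (ψ : (A → ℝ) → ℝ) (x : A → ℝ) : ℝ :=
  ψ (simplexProj x) + (∑ a, x a - 1) ^ 2 / 2

/-- The open set of points that project into the relative interior of the simplex. -/
noncomputable def regDomain (A : Type*) [Fintype A] : Set (A → ℝ) :=
  simplexProj ⁻¹' simplexInt A

theorem simplexProj_of_sum_eq_one {x : A → ℝ} (hx : ∑ a, x a = 1) : simplexProj x = x := by
  funext a
  simp [simplexProj, hx]

theorem regExt_of_sum_eq_one (ψ : (A → ℝ) → ℝ) {x : A → ℝ} (hx : ∑ a, x a = 1) :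
    regExt ψ x = ψ x := by
  simp [regExt, simplexProj_of_sum_eq_one hx, hx]

theorem simplexInt_subset_regDomain : simplexInt A ⊆ regDomain A := by
  intro p hp
  rw [regDomain, mem_preimage, simplexProj_of_sum_eq_one hp.2]
  exact hp

theorem contDiff_simplexProj {n : WithTop ℕ∞} : ContDiff ℝ n (simplexProj : (A → ℝ) → A → ℝ) := by
  unfold simplexProj
  fun_prop

theorem sum_simplexProj [Nonempty A] (x : A → ℝ) : ∑ a, simplexProj x a = 1 := by
  have : (Fintype.card A : ℝ) ≠ 0 := by simp
  simp only [simplexProj, Finset.sum_sub_distrib, Finset.sum_const, Finset.card_univ, nsmul_eq_mul]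
  field_simp
  ring

theorem isOpen_regDomain [Nonempty A] : IsOpen (regDomain A) := by
  have : regDomain A = ⋂ a, {x : A → ℝ | 0 < simplexProj x a} := by
    ext x
    simp [regDomain, simplexInt, sum_simplexProj]
  rw [this]
  refine isOpen_iInter_of_finite fun a => isOpen_lt continuous_const ?_
  exact (continuous_apply a).comp (contDiff_simplexProj (n := 0)).continuous

theorem sum_add_smul_of_mem_tangent {p v : A → ℝ} (hp : ∑ a, p a = 1) (hv : v ∈ simplexTangent A)
    (t : ℝ) : ∑ a, (p + t • v) a = 1 := by
  have hv' : ∑ a, v a = 0 := hv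
  simp [Finset.sum_add_distrib, ← Finset.mul_sum, hp, hv']

theorem lineDeriv_regExt (ψ : (A → ℝ) → ℝ) {p v : A → ℝ} (hp : ∑ a, p a = 1)
    (hv : v ∈ simplexTangent A) : lineDeriv ℝ (regExt ψ) p v = lineDeriv ℝ ψ p v := by
  unfold lineDeriv
  congr 1
  funext t
  exact regExt_of_sum_eq_one ψ (sum_add_smul_of_mem_tangent hp hv t)

theorem eventually_add_smul_mem_simplexInt {p w : A → ℝ} (hp : p ∈ simplexInt A)
    (hw : w ∈ simplexTangent A) : ∀ᶠ t : ℝ in 𝓝 0, p + t • w ∈ simplexInt A := by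
  have h : ∀ a, ∀ᶠ t : ℝ in 𝓝 0, 0 < (p + t • w) a := fun a => by
    have hc : ContinuousAt (fun t : ℝ => (p + t • w) a) 0 := by
      simp only [Pi.add_apply, Pi.smul_apply]
      fun_prop
    exact hc.eventually (lt_mem_nhds (by simpa using hp.1 a))
  filter_upwards [eventually_all.2 h] with t ht
  exact ⟨ht, sum_add_smul_of_mem_tangent hp.2 hw t⟩

namespace IsRegularizer

variable {ψ : (A → ℝ) → ℝ}

theorem contDiffOn_regExt (hψ : IsRegularizer ψ) :
    ContDiffOn ℝ 2 (regExt ψ) (regDomain A) := by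
  have h1 : ContDiffOn ℝ 2 (fun x => ψ (simplexProj x)) (regDomain A) :=
    hψ.contDiffOn.comp contDiff_simplexProj.contDiffOn fun _ hx => hx
  have h2 : ContDiff ℝ 2 fun x : A → ℝ => (∑ a, x a - 1) ^ 2 / 2 := by fun_prop
  exact h1.add h2.contDiffOn

theorem midpoint_gap_pos (hψ : IsRegularizer ψ) {p q : A → ℝ} (hp : p ∈ stdSimplex ℝ A)
    (hq : q ∈ stdSimplex ℝ A) (hne : p ≠ q) :
    0 < ψ p + ψ q - 2 * ψ ((2⁻¹ : ℝ) • p + (2⁻¹ : ℝ) • q) := by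
  have h := hψ.strictConvexOn.2 hp hq hne (by norm_num : (0 : ℝ) < 2⁻¹)
    (by norm_num : (0 : ℝ) < 2⁻¹) (by norm_num)
  simp only [smul_eq_mul] at h
  linarith

variable [Nonempty A]

theorem contDiffAt_regExt (hψ : IsRegularizer ψ) {x : A → ℝ} (hx : x ∈ regDomain A) :
    ContDiffAt ℝ 2 (regExt ψ) x :=
  hψ.contDiffOn_regExt.contDiffAt (isOpen_regDomain.mem_nhds hx)

theorem contDiffAt_fderiv_regExt (hψ : IsRegularizer ψ) {x : A → ℝ} (hx : x ∈ regDomain A) :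
    ContDiffAt ℝ 1 (fderiv ℝ (regExt ψ)) x :=
  (hψ.contDiffAt_regExt hx).fderiv_right (by norm_num)

theorem differentiableAt_regExt (hψ : IsRegularizer ψ) {x : A → ℝ} (hx : x ∈ regDomain A) :
    DifferentiableAt ℝ (regExt ψ) x :=
  (hψ.contDiffAt_regExt hx).differentiableAt (by norm_num)

theorem differentiableAt_fderiv_regExt (hψ : IsRegularizer ψ) {x : A → ℝ}
    (hx : x ∈ regDomain A) : DifferentiableAt ℝ (fderiv ℝ (regExt ψ)) x :=
  (hψ.contDiffAt_fderiv_regExt hx).differentiableAt (by norm_num)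

theorem lineDeriv_eq (hψ : IsRegularizer ψ) {p v : A → ℝ} (hp : p ∈ simplexInt A)
    (hv : v ∈ simplexTangent A) : lineDeriv ℝ ψ p v = fderiv ℝ (regExt ψ) p v := by
  rw [← lineDeriv_regExt ψ hp.2 hv]
  exact (hψ.differentiableAt_regExt (simplexInt_subset_regDomain hp)).lineDeriv_eq_fderiv

theorem hasLineDerivAt (hψ : IsRegularizer ψ) {p v : A → ℝ} (hp : p ∈ simplexInt A)
    (hv : v ∈ simplexTangent A) : HasLineDerivAt ℝ ψ (lineDeriv ℝ ψ p v) p v := by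
  rw [hψ.lineDeriv_eq hp hv]
  have h := (hψ.differentiableAt_regExt
    (simplexInt_subset_regDomain hp)).hasFDerivAt.hasLineDerivAt v
  unfold HasLineDerivAt at h ⊢
  refine h.congr_of_eventuallyEq (Eventually.of_forall fun t => ?_)
  exact (regExt_of_sum_eq_one ψ (sum_add_smul_of_mem_tangent hp.2 hv t)).symm

theorem bregman_eq (hψ : IsRegularizer ψ) {p q : A → ℝ} (hp : p ∈ stdSimplex ℝ A)
    (hq : q ∈ simplexInt A) :
    bregman ψ p q = ψ p - regExt ψ q - fderiv ℝ (regExt ψ) q (p - q) := by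
  rw [bregman, hψ.lineDeriv_eq hq (sub_mem_simplexTangent hp.2 hq.2), regExt_of_sum_eq_one ψ hq.2]

theorem hessForm_eq (hψ : IsRegularizer ψ) {p u w : A → ℝ} (hp : p ∈ simplexInt A)
    (hu : u ∈ simplexTangent A) (hw : w ∈ simplexTangent A) :
    hessForm ψ p u w = fderiv ℝ (fderiv ℝ (regExt ψ)) p w u := by
  have h := ((hψ.differentiableAt_fderiv_regExt
    (simplexInt_subset_regDomain hp)).hasFDerivAt.clm_apply
      (hasFDerivAt_const u p)).hasLineDerivAt w
  have h' : HasLineDerivAt ℝ (fun q => lineDeriv ℝ ψ q u)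
      (fderiv ℝ (fderiv ℝ (regExt ψ)) p w u) p w := by
    unfold HasLineDerivAt at h ⊢
    refine HasDerivAt.congr_of_eventuallyEq (by simpa using h) ?_
    filter_upwards [eventually_add_smul_mem_simplexInt hp hw] with t ht
    exact hψ.lineDeriv_eq ht hu
  exact h'.lineDeriv

theorem fderiv_fderiv_regExt_comm (hψ : IsRegularizer ψ) {x : A → ℝ} (hx : x ∈ regDomain A)
    (u w : A → ℝ) : fderiv ℝ (fderiv ℝ (regExt ψ)) x u w =
      fderiv ℝ (fderiv ℝ (regExt ψ)) x w u :=
  (hψ.contDiffAt_regExt hx).isSymmSndFDerivAt (by simp) u w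

/-- In the direction transversal to the simplex the extended regularizer is the quadratic term. -/
theorem fderiv_regExt_one (hψ : IsRegularizer ψ) {x : A → ℝ} (hx : x ∈ regDomain A) :
    fderiv ℝ (regExt ψ) x 1 = Fintype.card A * (∑ a, x a - 1) := by
  have hn : (Fintype.card A : ℝ) ≠ 0 := by simp
  rw [← (hψ.differentiableAt_regExt hx).lineDeriv_eq_fderiv]
  refine HasLineDerivAt.lineDeriv ?_
  have : (fun t : ℝ => regExt ψ (x + t • 1)) =
      fun t => ψ (simplexProj x) + (∑ a, x a + t * Fintype.card A - 1) ^ 2 / 2 := by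
    funext t
    have hs : ∑ a, (x + t • (1 : A → ℝ)) a = ∑ a, x a + t * Fintype.card A := by
      simp [Finset.sum_add_distrib, mul_comm]
    have hp : simplexProj (x + t • (1 : A → ℝ)) = simplexProj x := by
      funext a
      simp only [simplexProj, hs]
      simp
      field_simp
      ring
    rw [regExt, hp, hs]
  unfold HasLineDerivAt
  rw [this]
  have h : HasDerivAt (fun t : ℝ => ∑ a, x a + t * Fintype.card A - 1) (Fintype.card A : ℝ) 0 := by
    simpa using (((hasDerivAt_id (0 : ℝ)).mul_const (Fintype.card A : ℝ)).const_add
      (∑ a, x a)).sub_const 1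
  refine (((h.pow 2).div_const 2).const_add _).congr_deriv ?_
  simp
  ring

theorem fderiv_fderiv_regExt_one (hψ : IsRegularizer ψ) {x : A → ℝ} (hx : x ∈ regDomain A)
    (y : A → ℝ) : fderiv ℝ (fderiv ℝ (regExt ψ)) x y 1 = Fintype.card A * ∑ a, y a := by
  have h := ((hψ.differentiableAt_fderiv_regExt hx).hasFDerivAt.clm_apply
      (hasFDerivAt_const (1 : A → ℝ) x)).hasLineDerivAt y
  have h2 : HasLineDerivAt ℝ (fun x : A → ℝ => (Fintype.card A : ℝ) * (∑ a, x a - 1))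
      (Fintype.card A * ∑ a, y a) x y := by
    unfold HasLineDerivAt
    have : (fun t : ℝ => (Fintype.card A : ℝ) * (∑ a, (x + t • y) a - 1)) =
        fun t => (Fintype.card A : ℝ) * (∑ a, x a + t * ∑ a, y a - 1) := by
      funext t
      simp [Finset.sum_add_distrib, Finset.mul_sum]
    rw [this]
    simpa using ((((hasDerivAt_id (0 : ℝ)).mul_const (∑ a, y a)).const_add
      (∑ a, x a)).sub_const 1).const_mul (Fintype.card A : ℝ)
  have h3 := h2.congr_of_eventuallyEq (f₁ := fun q => fderiv ℝ (regExt ψ) q 1) <| by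
    filter_upwards [isOpen_regDomain.mem_nhds hx] with z hz using hψ.fderiv_regExt_one hz
  simpa using h.unique h3

theorem eq_zero_of_fderiv_fderiv_regExt_eq_zero (hψ : IsRegularizer ψ) {p y : A → ℝ}
    (hp : p ∈ simplexInt A) (hy : fderiv ℝ (fderiv ℝ (regExt ψ)) p y = 0) : y = 0 := by
  have h1 := hψ.fderiv_fderiv_regExt_one (simplexInt_subset_regDomain hp) y
  have hy' : y ∈ simplexTangent A := by
    rw [hy] at h1
    simpa [simplexTangent] using h1.symm
  by_contra hne
  have h2 := hψ.hess_pos p hp y hy' hne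
  rw [hψ.hessForm_eq hp hy' hy', hy] at h2
  simp at h2

/-- The gradient inequality at relative interior points. -/
theorem lineDeriv_le_sub (hψ : IsRegularizer ψ) {p q : A → ℝ} (hp : p ∈ stdSimplex ℝ A)
    (hq : q ∈ simplexInt A) : lineDeriv ℝ ψ q (p - q) ≤ ψ p - ψ q := by
  have h := (hψ.hasLineDerivAt hq (sub_mem_simplexTangent hp.2 hq.2)).tendsto_slope_zero_right
  refine le_of_tendsto h ?_
  filter_upwards [Ioo_mem_nhdsGT (zero_lt_one' ℝ)] with t ht
  have hc := hψ.strictConvexOn.convexOn.2 (simplexInt_subset_stdSimplex hq) hp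
    (sub_nonneg.2 ht.2.le) ht.1.le (by ring)
  have he : q + t • (p - q) = (1 - t) • q + t • p := by
    module
  rw [he, smul_eq_mul, inv_mul_le_iff₀ ht.1]
  simp only [smul_eq_mul] at hc
  linarith

/-- The Bregman divergence is bounded from below by a midpoint convexity gap, which unlike the
divergence itself makes sense up to the boundary in both arguments. -/
theorem midpoint_gap_le_bregman (hψ : IsRegularizer ψ) {p q : A → ℝ} (hp : p ∈ stdSimplex ℝ A)
    (hq : q ∈ simplexInt A) :
    ψ p + ψ q - 2 * ψ ((2⁻¹ : ℝ) • p + (2⁻¹ : ℝ) • q) ≤ bregman ψ p q := by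
  have hq' := simplexInt_subset_stdSimplex hq
  have hm : (2⁻¹ : ℝ) • p + (2⁻¹ : ℝ) • q ∈ stdSimplex ℝ A :=
    convex_stdSimplex ℝ A hp hq' (by norm_num) (by norm_num) (by norm_num)
  have h := hψ.lineDeriv_le_sub hm hq
  have he : p - q = (2 : ℝ) • ((2⁻¹ : ℝ) • p + (2⁻¹ : ℝ) • q - q) := by
    module
  rw [bregman, he, lineDeriv_smul, smul_eq_mul]
  linarith

theorem bregman_pos (hψ : IsRegularizer ψ) {p q : A → ℝ} (hp : p ∈ stdSimplex ℝ A)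
    (hq : q ∈ simplexInt A) (hne : p ≠ q) : 0 < bregman ψ p q :=
  (hψ.midpoint_gap_pos hp (simplexInt_subset_stdSimplex hq) hne).trans_le
    (hψ.midpoint_gap_le_bregman hp hq)

theorem bregman_self (hψ : IsRegularizer ψ) {p : A → ℝ} (hp : p ∈ simplexInt A) :
    bregman ψ p p = 0 := by
  rw [hψ.bregman_eq (simplexInt_subset_stdSimplex hp) hp, regExt_of_sum_eq_one ψ hp.2]
  simp

theorem bregman_nonneg (hψ : IsRegularizer ψ) {p q : A → ℝ} (hp : p ∈ stdSimplex ℝ A)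
    (hq : q ∈ simplexInt A) : 0 ≤ bregman ψ p q := by
  rcases eq_or_ne p q with rfl | hne
  · exact (hψ.bregman_self hq).ge
  · exact (hψ.bregman_pos hp hq hne).le

/-- The derivative of the Bregman divergence in its second argument. -/
theorem hasDerivWithinAt_bregman (hψ : IsRegularizer ψ) {p : A → ℝ} (hp : p ∈ stdSimplex ℝ A)
    {x : ℝ → A → ℝ} {v : A → ℝ} {I : Set ℝ} {t : ℝ} (ht : t ∈ I) (hx : ∀ τ ∈ I, x τ ∈ simplexInt A)
    (hv : v ∈ simplexTangent A) (h : HasDerivWithinAt x v I t) :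
    HasDerivWithinAt (fun τ => bregman ψ p (x τ)) (-hessForm ψ (x t) v (p - x t)) I t := by
  have hd := simplexInt_subset_regDomain (hx t ht)
  have h1 := (hψ.differentiableAt_regExt hd).hasFDerivAt.comp_hasDerivWithinAt t h
  have h2 := (hψ.differentiableAt_fderiv_regExt hd).hasFDerivAt.comp_hasDerivWithinAt t h
  have h3 := (h1.const_sub (ψ p)).sub (h2.clm_apply (h.const_sub p))
  have h4 : HasDerivWithinAt (fun τ => bregman ψ p (x τ)) _ I t :=
    h3.congr (fun τ hτ => hψ.bregman_eq hp (hx τ hτ)) (hψ.bregman_eq hp (hx t ht))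
  refine h4.congr_deriv ?_
  rw [hψ.hessForm_eq (hx t ht) hv (sub_mem_simplexTangent hp.2 (hx t ht).2),
    hψ.fderiv_fderiv_regExt_comm hd]
  simp

/-- Near a point `p` of the simplex, which may lie on the boundary, reflecting `p` at a point of the
simplex stays in the simplex; hence the gradient terms of the Bregman divergence are controlled by
the oscillation of `ψ`. -/
theorem tendsto_bregman_zero (hψ : IsRegularizer ψ) (hc : ContinuousOn ψ (stdSimplex ℝ A))
    {p : A → ℝ} (hp : p ∈ stdSimplex ℝ A) :
    Tendsto (bregman ψ p) (𝓝[simplexInt A] p) (𝓝 0) := by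
  have hpos : ∀ᶠ q in 𝓝[simplexInt A] p, (2 : ℝ) • q - p ∈ stdSimplex ℝ A := by
    have h : ∀ a, ∀ᶠ q in 𝓝[simplexInt A] p, 0 ≤ ((2 : ℝ) • q - p) a := fun a => by
      rcases (hp.1 a).eq_or_lt with h0 | h0
      · filter_upwards [self_mem_nhdsWithin] with q hq
        simpa [← h0] using (hq.1 a).le
      · have hca : ContinuousAt (fun q : A → ℝ => ((2 : ℝ) • q - p) a) p := by
          simp only [Pi.sub_apply, Pi.smul_apply, smul_eq_mul]
          exact ((continuous_const.mul (continuous_apply a)).sub continuous_const).continuousAt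
        refine mem_nhdsWithin_of_mem_nhds ?_
        filter_upwards [hca.eventually (lt_mem_nhds (a := (0 : ℝ)) (by
          simp only [Pi.sub_apply, Pi.smul_apply, smul_eq_mul]; linarith))] with q hq using hq.le
    filter_upwards [eventually_all.2 h, self_mem_nhdsWithin] with q hq hq'
    refine ⟨hq, ?_⟩
    simp [Finset.sum_sub_distrib, ← Finset.mul_sum, hq'.2, hp.2]
    norm_num
  have hid : Tendsto (fun q : A → ℝ => q) (𝓝[simplexInt A] p) (𝓝[stdSimplex ℝ A] p) :=
    tendsto_nhdsWithin_mono_left simplexInt_subset_stdSimplex tendsto_id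
  have hrefl : Tendsto (fun q : A → ℝ => (2 : ℝ) • q - p) (𝓝[simplexInt A] p)
      (𝓝[stdSimplex ℝ A] p) := by
    refine tendsto_nhdsWithin_iff.2 ⟨?_, hpos⟩
    have : ContinuousAt (fun q : A → ℝ => (2 : ℝ) • q - p) p := by fun_prop
    have h2 : (2 : ℝ) • p - p = p := by module
    have h3 := this.tendsto
    rw [h2] at h3
    exact h3.mono_left nhdsWithin_le_nhds
  have hup : Tendsto (fun q => ψ p - ψ q + (ψ ((2 : ℝ) • q - p) - ψ q)) (𝓝[simplexInt A] p)
      (𝓝 0) := by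
    have h1 := (hc p hp).tendsto.comp hid
    have h2 := (hc p hp).tendsto.comp hrefl
    simpa using (tendsto_const_nhds (x := ψ p)).sub h1 |>.add (h2.sub h1)
  refine squeeze_zero' ?_ ?_ hup
  · filter_upwards [self_mem_nhdsWithin] with q hq using hψ.bregman_nonneg hp hq
  · filter_upwards [self_mem_nhdsWithin, hpos] with q hq hx
    have h := hψ.lineDeriv_le_sub hx hq
    have he : (2 : ℝ) • q - p - q = (-1 : ℝ) • (p - q) := by module
    rw [he, lineDeriv_smul] at h
    rw [bregman]
    simp only [smul_eq_mul] at h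
    linarith

theorem tendsto_of_tendsto_bregman_zero (hψ : IsRegularizer ψ)
    (hc : ContinuousOn ψ (stdSimplex ℝ A)) {p : A → ℝ} (hp : p ∈ stdSimplex ℝ A) {ι : Type*}
    {l : Filter ι} {q : ι → A → ℝ} (hq : ∀ᶠ i in l, q i ∈ simplexInt A)
    (h : Tendsto (fun i => bregman ψ p (q i)) l (𝓝 0)) : Tendsto q l (𝓝 p) := by
  set g : (A → ℝ) → ℝ := fun q => ψ p + ψ q - 2 * ψ ((2⁻¹ : ℝ) • p + (2⁻¹ : ℝ) • q) with hg
  have hgc : ContinuousOn g (stdSimplex ℝ A) := by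
    refine (continuousOn_const.add hc).sub (continuousOn_const.mul (hc.comp (by fun_prop) ?_))
    exact fun x hx => convex_stdSimplex ℝ A hp hx (by norm_num) (by norm_num) (by norm_num)
  have hpos : ∀ x ∈ stdSimplex ℝ A, x ≠ p → 0 < g x := fun x hx hne =>
    hψ.midpoint_gap_pos hp hx hne.symm
  have hg0 : g p = 0 := by
    have : (2⁻¹ : ℝ) • p + (2⁻¹ : ℝ) • p = p := by module
    simp only [hg, this]
    ring
  have hqs : ∀ᶠ i in l, q i ∈ stdSimplex ℝ A := hq.mono fun i hi => simplexInt_subset_stdSimplex hi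
  have hlim : Tendsto (fun i => g (q i)) l (𝓝 0) := by
    refine squeeze_zero' ?_ ?_ h
    · filter_upwards [hqs] with i hi
      rcases eq_or_ne (q i) p with he | hne
      · rw [he, hg0]
      · exact (hpos _ hi hne).le
    · filter_upwards [hq] with i hi using hψ.midpoint_gap_le_bregman hp hi
  refine (isCompact_stdSimplex ℝ A).tendsto_nhds_of_unique_mapClusterPt hqs fun x hx hcl => ?_
  by_contra hne
  have h1 : ∀ᶠ y in 𝓝[stdSimplex ℝ A] x, g x / 2 < g y :=
    (hgc x hx).eventually (lt_mem_nhds (half_lt_self (hpos x hx hne)))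
  have h2 : ∀ᶠ i in l, g (q i) < g x / 2 :=
    hlim.eventually (gt_mem_nhds (half_pos (hpos x hx hne)))
  obtain ⟨i, hi1, hi2, hi3⟩ :=
    ((hcl.frequently (eventually_nhdsWithin_iff.1 h1)).and_eventually (h2.and hqs)).exists
  exact lt_irrefl _ ((hi1 hi3).trans hi2)

end IsRegularizer

end Regularizer

/-! ### State distributions, action values and the reward -/

theorem isCompact_policies (S A : Type*) [Fintype A] : IsCompact (policies S A) := by
  have : policies S A = Set.pi univ fun _ => stdSimplex ℝ A := by
    ext π
    simp [policies]
  rw [this]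
  exact isCompact_univ_pi fun _ => isCompact_stdSimplex ℝ A

theorem policiesInt_subset_policies (S A : Type*) [Fintype A] :
    policiesInt S A ⊆ policies S A :=
  fun _ hπ s => simplexInt_subset_stdSimplex (hπ s)

namespace FiniteMDP

variable {S A : Type*} [Fintype S] [Fintype A] (M : FiniteMDP S A)

theorem one_sub_γ_pos : 0 < 1 - M.γ := sub_pos.2 M.γ_lt_one

theorem stateLaw_nonneg {π : S → A → ℝ} (hπ : π ∈ policies S A) (t : ℕ) (s : S) :
    0 ≤ M.stateLaw π t s := by
  induction t generalizing s with
  | zero => exact M.μ_mem.1 s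
  | succ t ih =>
    exact Finset.sum_nonneg fun s' _ => Finset.sum_nonneg fun a _ =>
      mul_nonneg (mul_nonneg (ih s') ((hπ s').1 a)) ((M.P_mem s' a).1 s)

theorem sum_stateLaw {π : S → A → ℝ} (hπ : π ∈ policies S A) (t : ℕ) :
    ∑ s, M.stateLaw π t s = 1 := by
  induction t with
  | zero => exact M.μ_mem.2
  | succ t ih =>
    simp only [stateLaw]
    rw [Finset.sum_comm]
    calc ∑ s, ∑ s', ∑ a, M.stateLaw π t s * π s a * M.P s a s'
        = ∑ s, M.stateLaw π t s := by
          refine Finset.sum_congr rfl fun s _ => ?_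
          rw [Finset.sum_comm]
          simp_rw [← Finset.mul_sum, (M.P_mem s _).2, mul_one, ← Finset.mul_sum, (hπ s).2, mul_one]
      _ = 1 := ih

theorem stateLaw_le_one {π : S → A → ℝ} (hπ : π ∈ policies S A) (t : ℕ) (s : S) :
    M.stateLaw π t s ≤ 1 := by
  rw [← M.sum_stateLaw hπ t]
  exact Finset.single_le_sum (fun s _ => M.stateLaw_nonneg hπ t s) (Finset.mem_univ s)

theorem norm_stateLaw_le {π : S → A → ℝ} (hπ : π ∈ policies S A) (t : ℕ) (s : S) :
    ‖M.γ ^ t * M.stateLaw π t s‖ ≤ M.γ ^ t := by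
  rw [norm_mul, Real.norm_of_nonneg (pow_nonneg M.γ_nonneg t),
    Real.norm_of_nonneg (M.stateLaw_nonneg hπ t s)]
  exact mul_le_of_le_one_right (pow_nonneg M.γ_nonneg t) (M.stateLaw_le_one hπ t s)

theorem summable_stateLaw {π : S → A → ℝ} (hπ : π ∈ policies S A) (s : S) :
    Summable fun t => M.γ ^ t * M.stateLaw π t s :=
  (summable_geometric_of_lt_one M.γ_nonneg M.γ_lt_one).of_norm_bounded
    fun t => M.norm_stateLaw_le hπ t s

theorem continuous_stateLaw (t : ℕ) (s : S) : Continuous fun π => M.stateLaw π t s := by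
  induction t generalizing s with
  | zero => exact continuous_const
  | succ t ih =>
    simp only [stateLaw]
    fun_prop

theorem continuousOn_stateDist (s : S) :
    ContinuousOn (fun π => M.stateDist π s) (policies S A) :=
  continuousOn_const.mul <| continuousOn_tsum
    (fun t => (continuous_const.mul (M.continuous_stateLaw t s)).continuousOn)
    (summable_geometric_of_lt_one M.γ_nonneg M.γ_lt_one)
    fun t _ hπ => M.norm_stateLaw_le hπ t s

theorem stateDist_nonneg {π : S → A → ℝ} (hπ : π ∈ policies S A) (s : S) :
    0 ≤ M.stateDist π s :=
  mul_nonneg M.one_sub_γ_pos.le <| tsum_nonneg fun t =>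
    mul_nonneg (pow_nonneg M.γ_nonneg t) (M.stateLaw_nonneg hπ t s)

/-- The balance equation of the discounted state distribution. -/
theorem stateDist_balance {π : S → A → ℝ} (hπ : π ∈ policies S A) (s' : S) :
    M.stateDist π s' = (1 - M.γ) * M.μ s' +
      M.γ * ∑ s, ∑ a, M.stateDist π s * π s a * M.P s a s' := by
  have hs : ∀ s, HasSum (fun t => M.γ ^ t * M.stateLaw π t s) (∑' t, M.γ ^ t * M.stateLaw π t s) :=
    fun s => (M.summable_stateLaw hπ s).hasSum
  have h1 : HasSum (fun t => M.γ ^ (t + 1) * M.stateLaw π (t + 1) s')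
      (M.γ * ∑ s, ∑ a, (∑' t, M.γ ^ t * M.stateLaw π t s) * π s a * M.P s a s') := by
    have h := (hasSum_sum fun s (_ : s ∈ Finset.univ) => hasSum_sum fun a
      (_ : a ∈ Finset.univ) => ((hs s).mul_right (π s a)).mul_right (M.P s a s')).mul_left M.γ
    convert! h using 2 with t
    simp only [stateLaw, pow_succ, Finset.mul_sum]
    refine Finset.sum_congr rfl fun s _ => Finset.sum_congr rfl fun a _ => by ring
  have h2 := (M.summable_stateLaw hπ s').tsum_eq_zero_add
  rw [h1.tsum_eq] at h2
  rw [stateDist, h2]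
  simp only [stateDist, stateLaw, pow_zero, one_mul, mul_add, Finset.mul_sum]
  congr 1
  refine Finset.sum_congr rfl fun s _ => Finset.sum_congr rfl fun a _ => by ring

theorem le_stateDist {π : S → A → ℝ} (hπ : π ∈ policies S A) (s : S) :
    (1 - M.γ) * M.μ s ≤ M.stateDist π s := by
  rw [M.stateDist_balance hπ s]
  refine le_add_of_nonneg_right (mul_nonneg M.γ_nonneg ?_)
  exact Finset.sum_nonneg fun s' _ => Finset.sum_nonneg fun a _ =>
    mul_nonneg (mul_nonneg (M.stateDist_nonneg hπ s') ((hπ s').1 a)) ((M.P_mem s' a).1 s)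

theorem reward_eq_sum {π : S → A → ℝ} (hπ : π ∈ policies S A) :
    M.reward π = ∑ s, ∑ a, M.stateDist π s * π s a * M.r s a := by
  have hs : ∀ s, HasSum (fun t => M.γ ^ t * M.stateLaw π t s) (∑' t, M.γ ^ t * M.stateLaw π t s) :=
    fun s => (M.summable_stateLaw hπ s).hasSum
  have h := hasSum_sum fun s (_ : s ∈ Finset.univ) => hasSum_sum fun a
    (_ : a ∈ Finset.univ) => ((hs s).mul_right (π s a)).mul_right (M.r s a)
  have h' : HasSum (fun t => M.γ ^ t * ∑ s, ∑ a, M.stateLaw π t s * π s a * M.r s a)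
      (∑ s, ∑ a, (∑' t, M.γ ^ t * M.stateLaw π t s) * π s a * M.r s a) := by
    convert! h using 2 with t
    simp only [Finset.mul_sum]
    refine Finset.sum_congr rfl fun s _ => Finset.sum_congr rfl fun a _ => by ring
  rw [reward, h'.tsum_eq]
  simp only [stateDist, Finset.mul_sum]
  refine Finset.sum_congr rfl fun s _ => Finset.sum_congr rfl fun a _ => by ring

theorem continuousOn_reward : ContinuousOn M.reward (policies S A) := by
  have h : ContinuousOn (fun π : S → A → ℝ => ∑ s, ∑ a, M.stateDist π s * π s a * M.r s a)
      (policies S A) := by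
    refine continuousOn_finsetSum _ fun s _ => continuousOn_finsetSum _ fun a _ => ?_
    refine ((M.continuousOn_stateDist s).mul ?_).mul continuousOn_const
    fun_prop
  exact h.congr fun π hπ => M.reward_eq_sum hπ

/-- A policy that agrees with another one on all states that it visits has the same discounted state
distribution, since the balance equation has only one solution. -/
theorem stateDist_eq_of_eq_on_support {π π' : S → A → ℝ} (hπ : π ∈ policies S A)
    (hπ' : π' ∈ policies S A) (h : ∀ s, 0 < M.stateDist π s → π s = π' s) :
    M.stateDist π = M.stateDist π' := by
  have hb : ∀ s', M.stateDist π s' - M.stateDist π' s' =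
      M.γ * ∑ s, ∑ a, (M.stateDist π s - M.stateDist π' s) * π' s a * M.P s a s' := by
    intro s'
    have h1 : ∑ s, ∑ a, M.stateDist π s * π s a * M.P s a s' =
        ∑ s, ∑ a, M.stateDist π s * π' s a * M.P s a s' := by
      refine Finset.sum_congr rfl fun s _ => Finset.sum_congr rfl fun a _ => ?_
      rcases (M.stateDist_nonneg hπ s).eq_or_lt with h0 | h0
      · simp [← h0]
      · rw [h s h0]
    rw [M.stateDist_balance hπ s', M.stateDist_balance hπ' s', h1]
    simp only [sub_mul, Finset.sum_sub_distrib]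
    ring
  have hle : ∑ s', |M.stateDist π s' - M.stateDist π' s'| ≤
      M.γ * ∑ s, |M.stateDist π s - M.stateDist π' s| := by
    calc ∑ s', |M.stateDist π s' - M.stateDist π' s'|
        ≤ ∑ s', M.γ * ∑ s, ∑ a, |M.stateDist π s - M.stateDist π' s| * π' s a * M.P s a s' := by
          refine Finset.sum_le_sum fun s' _ => ?_
          rw [hb s', abs_mul, abs_of_nonneg M.γ_nonneg]
          refine mul_le_mul_of_nonneg_left ?_ M.γ_nonneg
          refine (Finset.abs_sum_le_sum_abs _ _).trans (Finset.sum_le_sum fun s _ => ?_)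
          refine (Finset.abs_sum_le_sum_abs _ _).trans (Finset.sum_le_sum fun a _ => ?_)
          rw [abs_mul, abs_mul, abs_of_nonneg ((hπ' s).1 a), abs_of_nonneg ((M.P_mem s a).1 s')]
      _ = M.γ * ∑ s, |M.stateDist π s - M.stateDist π' s| := by
          rw [← Finset.mul_sum, Finset.sum_comm]
          congr 1
          refine Finset.sum_congr rfl fun s _ => ?_
          rw [Finset.sum_comm]
          simp_rw [← Finset.mul_sum, (M.P_mem s _).2, mul_one, ← Finset.mul_sum, (hπ' s).2, mul_one]
  have h0 : ∑ s, |M.stateDist π s - M.stateDist π' s| = 0 := by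
    have hn : 0 ≤ ∑ s, |M.stateDist π s - M.stateDist π' s| :=
      Finset.sum_nonneg fun s _ => abs_nonneg _
    nlinarith [M.one_sub_γ_pos]
  funext s
  have := (Finset.sum_eq_zero_iff_of_nonneg fun s _ => abs_nonneg _).1 h0 s (Finset.mem_univ s)
  exact sub_eq_zero.1 (abs_eq_zero.1 this)

/-- The discounted transition operator `f ↦ γ ∑ₐ π(a|·) ∑ₛ' P(s'|·,a) f(s')` of a policy. -/
noncomputable def transOp (π : S → A → ℝ) : (S → ℝ) →L[ℝ] (S → ℝ) :=
  ContinuousLinearMap.pi fun s =>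
    ∑ a, π s a • ∑ s', (M.γ * M.P s a s') • ContinuousLinearMap.proj (R := ℝ) (φ := fun _ => ℝ) s'

theorem transOp_apply (π : S → A → ℝ) (f : S → ℝ) (s : S) :
    M.transOp π f s = ∑ a, π s a * ∑ s', M.γ * M.P s a s' * f s' := by
  simp [transOp]

/-- The value function `(1 - γ P_π)⁻¹ r_π`, without the normalizing factor `1 - γ`. -/
noncomputable def valueFn (π : S → A → ℝ) : S → ℝ :=
  Ring.inverse (1 - M.transOp π) fun s => ∑ a, π s a * M.r s a

/-- The action value function of a policy, without the normalizing factor `1 - γ`. -/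
noncomputable def qFn (π : S → A → ℝ) (s : S) (a : A) : ℝ :=
  M.r s a + ∑ s', M.γ * M.P s a s' * M.valueFn π s'

theorem isUnit_one_sub_transOp {π : S → A → ℝ} (hπ : π ∈ policies S A) :
    IsUnit (1 - M.transOp π) := by
  refine isUnit_one_sub_of_norm_lt_one (lt_of_le_of_lt ?_ M.γ_lt_one)
  refine ContinuousLinearMap.opNorm_le_bound _ M.γ_nonneg fun f => ?_
  refine (pi_norm_le_iff_of_nonneg (mul_nonneg M.γ_nonneg (norm_nonneg f))).2 fun s => ?_
  rw [transOp_apply]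
  calc ‖∑ a, π s a * ∑ s', M.γ * M.P s a s' * f s'‖
      ≤ ∑ a, π s a * ∑ s', M.γ * M.P s a s' * ‖f‖ := by
        refine norm_sum_le_of_le _ fun a _ => ?_
        rw [norm_mul, Real.norm_of_nonneg ((hπ s).1 a)]
        refine mul_le_mul_of_nonneg_left (norm_sum_le_of_le _ fun s' _ => ?_) ((hπ s).1 a)
        have hP := mul_nonneg M.γ_nonneg ((M.P_mem s a).1 s')
        rw [norm_mul, Real.norm_of_nonneg hP]
        exact mul_le_mul_of_nonneg_left (norm_le_pi_norm f s') hP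
    _ = M.γ * ‖f‖ := by
        simp_rw [← Finset.sum_mul, ← Finset.mul_sum, (M.P_mem s _).2, mul_one, ← Finset.sum_mul,
          (hπ s).2, one_mul]

/-- The Bellman equation. -/
theorem sum_mul_qFn {π : S → A → ℝ} (hπ : π ∈ policies S A) (s : S) :
    ∑ a, π s a * M.qFn π s a = M.valueFn π s := by
  have h := congrArg (fun L : (S → ℝ) →L[ℝ] (S → ℝ) => L (fun s => ∑ a, π s a * M.r s a) s)
    (Ring.mul_inverse_cancel _ (M.isUnit_one_sub_transOp hπ))
  change M.valueFn π s - M.transOp π (M.valueFn π) s = _ at h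
  rw [transOp_apply] at h
  change _ = ∑ a, π s a * M.r s a at h
  simp only [qFn, mul_add, Finset.sum_add_distrib]
  linarith

theorem contDiffAt_qFn {π : S → A → ℝ} (hπ : π ∈ policies S A) :
    ContDiffAt ℝ 1 M.qFn π := by
  have hT : ContDiff ℝ 1 M.transOp := by
    refine contDiff_clm_apply_iff.2 fun f => contDiff_pi.2 fun s => ?_
    simp only [transOp_apply]
    fun_prop
  obtain ⟨u, hu⟩ := M.isUnit_one_sub_transOp hπ
  have h1 : ContDiffAt ℝ 1 (fun π => Ring.inverse (1 - M.transOp π)) π := by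
    have hinv : ContDiffAt ℝ 1 Ring.inverse (1 - M.transOp π) := by
      rw [← hu]
      exact contDiffAt_ringInverse ℝ u
    exact hinv.comp π (contDiff_const.sub hT).contDiffAt
  have h2 : ContDiffAt ℝ 1 M.valueFn π := by
    refine h1.clm_apply ?_
    fun_prop
  have h3 : ∀ s, ContDiffAt ℝ 1 (fun π => M.valueFn π s) π := contDiffAt_pi.1 h2
  refine contDiffAt_pi.2 fun s => contDiffAt_pi.2 fun a => ?_
  unfold qFn
  exact contDiffAt_const.add (ContDiffAt.sum fun s' _ => contDiffAt_const.mul (h3 s'))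

/-- The performance difference lemma. -/
theorem reward_sub_reward {π q : S → A → ℝ} (hπ : π ∈ policies S A) (hq : q ∈ policies S A) :
    M.reward q - M.reward π =
      ∑ s, M.stateDist q s * ∑ a, (q s a - π s a) * M.qFn π s a := by
  have key : ∀ q ∈ policies S A, M.reward q = (1 - M.γ) * ∑ s, M.μ s * M.valueFn π s +
      ∑ s, M.stateDist q s * ∑ a, (q s a - π s a) * M.qFn π s a := by
    intro q hq
    have h1 : ∑ s', M.stateDist q s' * M.valueFn π s' =
        (1 - M.γ) * ∑ s, M.μ s * M.valueFn π s + ∑ s, ∑ a, M.stateDist q s * q s a *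
          ∑ s', M.γ * M.P s a s' * M.valueFn π s' := by
      have h2 : ∀ s', M.stateDist q s' * M.valueFn π s' =
          (1 - M.γ) * (M.μ s' * M.valueFn π s') + ∑ s, ∑ a, M.stateDist q s * q s a *
            (M.γ * M.P s a s' * M.valueFn π s') := by
        intro s'
        rw [M.stateDist_balance hq s', add_mul, Finset.mul_sum, Finset.sum_mul]
        congr 1
        · ring
        · refine Finset.sum_congr rfl fun s _ => ?_
          rw [Finset.mul_sum, Finset.sum_mul]
          exact Finset.sum_congr rfl fun a _ => by ring
      rw [Finset.sum_congr rfl fun s' _ => h2 s', Finset.sum_add_distrib, ← Finset.mul_sum]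
      congr 1
      rw [Finset.sum_comm]
      refine Finset.sum_congr rfl fun s _ => ?_
      rw [Finset.sum_comm]
      exact Finset.sum_congr rfl fun a _ => by rw [Finset.mul_sum]
    have h3 : ∀ s, M.stateDist q s * ∑ a, (q s a - π s a) * M.qFn π s a =
        ∑ a, M.stateDist q s * q s a * M.r s a + ∑ a, M.stateDist q s * q s a *
          ∑ s', M.γ * M.P s a s' * M.valueFn π s' - M.stateDist q s * M.valueFn π s := by
      intro s
      simp only [sub_mul, Finset.sum_sub_distrib]
      rw [M.sum_mul_qFn hπ s, mul_sub, Finset.mul_sum, ← Finset.sum_add_distrib]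
      congr 1
      exact Finset.sum_congr rfl fun a _ => by rw [qFn]; ring
    rw [Finset.sum_congr rfl fun s _ => h3 s, Finset.sum_sub_distrib, Finset.sum_add_distrib,
      h1, M.reward_eq_sum hq]
    ring
  rw [key q hq, key π hπ]
  simp

/-- The policy gradient theorem. -/
theorem hasLineDerivAt_reward {π w : S → A → ℝ} (hπ : π ∈ policiesInt S A)
    (hw : w ∈ policyTangent S A) :
    HasLineDerivAt ℝ M.reward (∑ s, M.stateDist π s * ∑ a, w s a * M.qFn π s a) π w := by
  have hπ' := policiesInt_subset_policies S A hπ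
  have hev : ∀ᶠ t : ℝ in 𝓝 0, π + t • w ∈ policiesInt S A := by
    filter_upwards [eventually_all.2 fun s => eventually_add_smul_mem_simplexInt (hπ s) (hw s)]
      with t ht using ht
  rw [hasLineDerivAt_iff_tendsto_slope_zero]
  have hlim : Tendsto (fun t : ℝ => π + t • w) (𝓝[≠] 0) (𝓝[policies S A] π) := by
    refine tendsto_nhdsWithin_iff.2 ⟨?_, (hev.filter_mono nhdsWithin_le_nhds).mono
      fun t ht => policiesInt_subset_policies S A ht⟩
    have hc : Continuous fun t : ℝ => π + t • w := by fun_prop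
    simpa using (hc.tendsto 0).mono_left nhdsWithin_le_nhds
  have hmain : Tendsto (fun t : ℝ => ∑ s, M.stateDist (π + t • w) s * ∑ a, w s a * M.qFn π s a)
      (𝓝[≠] 0) (𝓝 (∑ s, M.stateDist π s * ∑ a, w s a * M.qFn π s a)) :=
    tendsto_finsetSum _ fun s _ =>
      (((M.continuousOn_stateDist s) π hπ').tendsto.comp hlim).mul_const _
  refine hmain.congr' ?_
  filter_upwards [self_mem_nhdsWithin, hev.filter_mono nhdsWithin_le_nhds] with t ht hmem
  have ht' : t ≠ 0 := ht
  rw [M.reward_sub_reward hπ' (policiesInt_subset_policies S A hmem), smul_eq_mul,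
    eq_inv_mul_iff_mul_eq₀ ht', Finset.mul_sum]
  refine Finset.sum_congr rfl fun s _ => ?_
  rw [mul_left_comm, Finset.mul_sum]
  congr 1
  refine Finset.sum_congr rfl fun a _ => ?_
  simp
  ring

end FiniteMDP

/-! ### The divergence between policies along the gradient flow -/

theorem IsRegularizer.continuousOn_bregman_left {A : Type*} [Fintype A] [Nonempty A]
    {ψ : (A → ℝ) → ℝ} (hψ : IsRegularizer ψ) (hc : ContinuousOn ψ (stdSimplex ℝ A)) {q : A → ℝ}
    (hq : q ∈ simplexInt A) : ContinuousOn (fun p => bregman ψ p q) (stdSimplex ℝ A) := by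
  have h : ContinuousOn (fun p => ψ p - regExt ψ q - fderiv ℝ (regExt ψ) q (p - q))
      (stdSimplex ℝ A) :=
    (hc.sub continuousOn_const).sub (by fun_prop)
  exact h.congr fun p hp => hψ.bregman_eq hp hq

theorem convex_timeInterval (T : EReal) : Convex ℝ (timeInterval T) := by
  refine Set.OrdConnected.convex ⟨fun x hx y hy z hz => ⟨hx.1.trans hz.1, ?_⟩⟩
  exact lt_of_le_of_lt (EReal.coe_le_coe_iff.2 hz.2) hy.2

theorem timeInterval_top : timeInterval ⊤ = Ici 0 := by
  ext t
  simp [timeInterval, EReal.coe_lt_top]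

namespace FiniteMDP

variable {S A : Type*} [Fintype S] [Fintype A] (M : FiniteMDP S A)

theorem continuousOn_policyDiv_left [Nonempty A] {ψ : (A → ℝ) → ℝ} (hψ : IsRegularizer ψ)
    (hc : ContinuousOn ψ (stdSimplex ℝ A)) {π₀ : S → A → ℝ} (hπ₀ : π₀ ∈ policiesInt S A) :
    ContinuousOn (fun p => M.policyDiv ψ p π₀) (policies S A) :=
  continuousOn_finsetSum _ fun s _ => (M.continuousOn_stateDist s).mul <|
    (hψ.continuousOn_bregman_left hc (hπ₀ s)).comp (continuous_apply s).continuousOn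
      fun _ hp => hp s

theorem policyDiv_self [Nonempty A] {ψ : (A → ℝ) → ℝ} (hψ : IsRegularizer ψ) {p : S → A → ℝ}
    (hp : p ∈ policiesInt S A) : M.policyDiv ψ p p = 0 :=
  Finset.sum_eq_zero fun s _ => by rw [hψ.bregman_self (hp s), mul_zero]

theorem policyDiv_summand_nonneg [Nonempty A] {ψ : (A → ℝ) → ℝ} (hψ : IsRegularizer ψ)
    {q p : S → A → ℝ} (hq : q ∈ policies S A) (hp : p ∈ policiesInt S A) (s : S) :
    0 ≤ M.stateDist q s * bregman ψ (q s) (p s) :=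
  mul_nonneg (M.stateDist_nonneg hq s) (hψ.bregman_nonneg (hq s) (hp s))

theorem policyDiv_nonneg [Nonempty A] {ψ : (A → ℝ) → ℝ} (hψ : IsRegularizer ψ)
    {q p : S → A → ℝ} (hq : q ∈ policies S A) (hp : p ∈ policiesInt S A) :
    0 ≤ M.policyDiv ψ q p :=
  Finset.sum_nonneg fun s _ => M.policyDiv_summand_nonneg hψ hq hp s

/-- The divergence only sees the states that its first argument visits. It is nevertheless definite,
since a policy that agrees with `p` on the states that it visits has the state distribution of
`p`. -/
theorem eq_of_policyDiv_eq_zero [Nonempty A] (hM : M.Exploration) {ψ : (A → ℝ) → ℝ}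
    (hψ : IsRegularizer ψ) {q p : S → A → ℝ} (hq : q ∈ policies S A) (hp : p ∈ policiesInt S A)
    (h : M.policyDiv ψ q p = 0) : q = p := by
  have hs : ∀ s, 0 < M.stateDist q s → q s = p s := by
    intro s hd
    have h0 := (Finset.sum_eq_zero_iff_of_nonneg fun s _ =>
      M.policyDiv_summand_nonneg hψ hq hp s).1 h s (Finset.mem_univ s)
    by_contra hne
    exact (mul_pos hd (hψ.bregman_pos (hq s) (hp s) hne)).ne' h0
  have hd := M.stateDist_eq_of_eq_on_support hq (policiesInt_subset_policies S A hp) hs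
  funext s
  exact hs s (hd ▸ hM p hp s)

theorem tendsto_policyDiv_zero [Nonempty A] {ψ : (A → ℝ) → ℝ} (hψ : IsRegularizer ψ)
    (hc : ContinuousOn ψ (stdSimplex ℝ A)) {q : S → A → ℝ} (hq : q ∈ policies S A) :
    Tendsto (M.policyDiv ψ q) (𝓝[policiesInt S A] q) (𝓝 0) := by
  have h : Tendsto (M.policyDiv ψ q) (𝓝[policiesInt S A] q)
      (𝓝 (∑ s, M.stateDist q s * 0)) := by
    refine tendsto_finsetSum _ fun s _ => Tendsto.const_mul _ ?_
    refine (hψ.tendsto_bregman_zero hc (hq s)).comp (tendsto_nhdsWithin_iff.2 ⟨?_, ?_⟩)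
    · exact ((continuous_apply s).tendsto q).mono_left nhdsWithin_le_nhds
    · filter_upwards [self_mem_nhdsWithin] with p hp using hp s
  simpa using h

theorem tendsto_apply_of_tendsto_policyDiv_zero [Nonempty A] {ψ : (A → ℝ) → ℝ}
    (hψ : IsRegularizer ψ) (hc : ContinuousOn ψ (stdSimplex ℝ A)) {q : S → A → ℝ}
    (hq : q ∈ policies S A) {ι : Type*} {l : Filter ι} {π : ι → S → A → ℝ}
    (hπ : ∀ᶠ i in l, π i ∈ policiesInt S A)
    (h : Tendsto (fun i => M.policyDiv ψ q (π i)) l (𝓝 0)) {s : S} (hs : 0 < M.stateDist q s) :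
    Tendsto (fun i => π i s) l (𝓝 (q s)) := by
  refine hψ.tendsto_of_tendsto_bregman_zero hc (hq s) (hπ.mono fun i hi => hi s) ?_
  have h' := h.const_mul (M.stateDist q s)⁻¹
  rw [mul_zero] at h'
  refine squeeze_zero' ?_ ?_ h'
  · filter_upwards [hπ] with i hi using hψ.bregman_nonneg (hq s) (hi s)
  · filter_upwards [hπ] with i hi
    rw [le_inv_mul_iff₀ hs]
    exact Finset.single_le_sum (f := fun s => M.stateDist q s * bregman ψ (q s) (π i s))
      (fun s _ => M.policyDiv_summand_nonneg hψ hq hi s) (Finset.mem_univ s)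

/-- The gradient decouples over the states: since the metric weighs the states in the same way as
the policy gradient theorem does, the weights cancel, and only the action values remain. -/
theorem isGradient_iff (hM : M.Exploration) {ψ : (A → ℝ) → ℝ} {π v : S → A → ℝ}
    (hπ : π ∈ policiesInt S A) :
    M.IsGradient ψ π v ↔ v ∈ policyTangent S A ∧ ∀ s, ∀ w ∈ simplexTangent A,
      hessForm ψ (π s) (v s) w = ∑ a, w a * M.qFn π s a := by
  classical
  refine and_congr_right fun _ => ⟨fun h s w hw => ?_, fun h w hw => ?_⟩
  · have hw' : Pi.single s w ∈ policyTangent S A := by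
      intro s'
      rcases eq_or_ne s' s with rfl | hne
      · simpa using hw
      · simp [hne, simplexTangent]
    have h1 := (h _ hw').unique (M.hasLineDerivAt_reward hπ hw')
    rw [policyMetric, Finset.sum_eq_single s, Finset.sum_eq_single s] at h1
    · simpa [(hM π hπ s).ne'] using h1
    · intro s' _ hne
      simp [hne]
    · simp
    · intro s' _ hne
      simp [hne, hessForm, lineDeriv_zero]
    · simp
  · have h1 := M.hasLineDerivAt_reward hπ hw
    have h2 : M.policyMetric ψ π v w = ∑ s, M.stateDist π s * ∑ a, w s a * M.qFn π s a :=
      Finset.sum_congr rfl fun s _ => by rw [h s (w s) (hw s)]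
    rwa [h2]

variable {M}

/-- Along the gradient flow, the divergence to a fixed policy decreases at the rate at which that
policy outperforms the current one. -/
theorem IsFlow.hasDerivWithinAt_policyDiv [Nonempty A] (hM : M.Exploration) {ψ : (A → ℝ) → ℝ}
    (hψ : IsRegularizer ψ) {π₀ : S → A → ℝ} {T : EReal} {π : ℝ → S → A → ℝ}
    (h : M.IsFlow ψ π₀ T π) {q : S → A → ℝ} (hq : q ∈ policies S A) {t : ℝ}
    (ht : t ∈ timeInterval T) :
    HasDerivWithinAt (fun τ => M.policyDiv ψ q (π τ)) (-(M.reward q - M.reward (π t)))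
      (timeInterval T) t := by
  obtain ⟨v, hv, hd⟩ := h.eqn t ht
  obtain ⟨hvt, hv⟩ := (M.isGradient_iff hM (h.mem t ht)).1 hv
  have h1 : HasDerivWithinAt (fun τ => M.policyDiv ψ q (π τ))
      (∑ s, M.stateDist q s * -hessForm ψ (π t s) (v s) (q s - π t s)) (timeInterval T) t :=
    HasDerivWithinAt.fun_sum fun s _ => (hψ.hasDerivWithinAt_bregman (hq s) ht
      (fun τ hτ => h.mem τ hτ s) (hvt s) (hasDerivWithinAt_pi.1 hd s)).const_mul _
  refine h1.congr_deriv ?_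
  rw [M.reward_sub_reward (policiesInt_subset_policies S A (h.mem t ht)) hq,
    ← Finset.sum_neg_distrib]
  refine Finset.sum_congr rfl fun s _ => ?_
  rw [hv s _ (sub_mem_simplexTangent (hq s).2 (h.mem t ht s).2), mul_neg]
  rfl

/-- The regularized objective `t R(q) - D(q, π₀)` falls short of its value at the flow at time `t`
by exactly the divergence from `q` to the flow. -/
theorem IsFlow.regularized_reward_eq [Nonempty A] (hM : M.Exploration) {ψ : (A → ℝ) → ℝ}
    (hψ : IsRegularizer ψ) {π₀ : S → A → ℝ} {T : EReal} {π : ℝ → S → A → ℝ}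
    (h : M.IsFlow ψ π₀ T π) {q : S → A → ℝ} (hq : q ∈ policies S A) {t : ℝ}
    (ht : t ∈ timeInterval T) :
    t * M.reward q - M.policyDiv ψ q π₀ =
      t * M.reward (π t) - M.policyDiv ψ (π t) π₀ - M.policyDiv ψ q (π t) := by
  set p := π t with hp
  have hp' : p ∈ policies S A := policiesInt_subset_policies S A (h.mem t ht)
  have h0 : (0 : ℝ) ∈ timeInterval T :=
    ⟨le_rfl, lt_of_le_of_lt (EReal.coe_le_coe_iff.2 ht.1) ht.2⟩
  have hsub : Icc 0 t ⊆ timeInterval T := (convex_timeInterval T).ordConnected.out h0 ht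
  -- the derivatives of the two divergences differ by a constant
  have hd : ∀ τ ∈ Icc 0 t, HasDerivWithinAt (fun τ => M.policyDiv ψ q (π τ) -
      M.policyDiv ψ p (π τ) + τ * (M.reward q - M.reward p)) 0 (Icc 0 t) τ := by
    intro τ hτ
    refine HasDerivWithinAt.mono ?_ hsub
    refine (((h.hasDerivWithinAt_policyDiv hM hψ hq (hsub hτ)).sub
      (h.hasDerivWithinAt_policyDiv hM hψ hp' (hsub hτ))).add
      ((hasDerivWithinAt_id τ _).mul_const _)).congr_deriv ?_
    ring
  have hc := constant_of_derivWithin_zero (fun τ hτ => (hd τ hτ).differentiableWithinAt)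
    (fun τ hτ => (hd τ (Ico_subset_Icc_self hτ)).derivWithin
      (uniqueDiffOn_Icc (hτ.1.trans_lt hτ.2) τ (Ico_subset_Icc_self hτ))) t
    (right_mem_Icc.2 ht.1)
  have hself : M.policyDiv ψ p p = 0 := M.policyDiv_self hψ (h.mem t ht)
  simp only [h.init, ← hp, hself] at hc
  linarith

theorem IsFlow.policyDiv_sub_le [Nonempty A] (hM : M.Exploration) {ψ : (A → ℝ) → ℝ}
    (hψ : IsRegularizer ψ) {π₀ : S → A → ℝ} {T : EReal} {π : ℝ → S → A → ℝ}
    (h : M.IsFlow ψ π₀ T π) {q : S → A → ℝ} (hq : q ∈ policies S A) {t : ℝ}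
    (ht : t ∈ timeInterval T) :
    t * M.reward q - M.policyDiv ψ q π₀ ≤ t * M.reward (π t) - M.policyDiv ψ (π t) π₀ := by
  rw [h.regularized_reward_eq hM hψ hq ht]
  exact sub_le_self _ (M.policyDiv_nonneg hψ hq (h.mem t ht))

/-- The flow follows the central path of the regularized problems. -/
theorem IsFlow.maximizers_eq [Nonempty A] (hM : M.Exploration) {ψ : (A → ℝ) → ℝ}
    (hψ : IsRegularizer ψ) {π₀ : S → A → ℝ} {T : EReal} {π : ℝ → S → A → ℝ}
    (h : M.IsFlow ψ π₀ T π) {t : ℝ} (ht : t ∈ timeInterval T) (ht0 : 0 < t) :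
    {p ∈ policies S A | IsMaxOn (fun q => M.reward q - t⁻¹ * M.policyDiv ψ q π₀)
      (policies S A) p} = {π t} := by
  have hmem := policiesInt_subset_policies S A (h.mem t ht)
  have hscale : ∀ q, M.reward q - t⁻¹ * M.policyDiv ψ q π₀ =
      t⁻¹ * (t * M.reward q - M.policyDiv ψ q π₀) := fun q => by
    field_simp
  ext p
  simp only [mem_singleton_iff]
  constructor
  · rintro ⟨hp, hmax⟩
    have h1 := isMaxOn_iff.1 hmax (π t) hmem
    rw [hscale, hscale, mul_le_mul_iff_right₀ (inv_pos.2 ht0)] at h1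
    have h2 := h.regularized_reward_eq hM hψ hp ht
    have h3 := M.policyDiv_nonneg hψ hp (h.mem t ht)
    exact M.eq_of_policyDiv_eq_zero hM hψ hp (h.mem t ht) (by linarith)
  · rintro rfl
    refine ⟨hmem, isMaxOn_iff.2 fun q hq => ?_⟩
    rw [hscale, hscale, mul_le_mul_iff_right₀ (inv_pos.2 ht0)]
    exact h.policyDiv_sub_le hM hψ hq ht

/-- Two solutions agree, since both follow the central path. -/
theorem IsFlow.unique [Nonempty A] (hM : M.Exploration) {ψ : (A → ℝ) → ℝ}
    (hψ : IsRegularizer ψ) {π₀ : S → A → ℝ} {T₁ T₂ : EReal} {π₁ π₂ : ℝ → S → A → ℝ}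
    (h₁ : M.IsFlow ψ π₀ T₁ π₁) (h₂ : M.IsFlow ψ π₀ T₂ π₂) {t : ℝ}
    (ht : t ∈ timeInterval T₁ ∩ timeInterval T₂) : π₁ t = π₂ t := by
  rcases ht.1.1.eq_or_lt with rfl | ht0
  · rw [h₁.init, h₂.init]
  · have h := (h₁.maximizers_eq hM hψ ht.1 ht0).symm.trans (h₂.maximizers_eq hM hψ ht.2 ht0)
    exact singleton_eq_singleton_iff.1 h

/-! ### Sublinear convergence -/

theorem isGreatest_optReward (h : (policies S A).Nonempty) :
    IsGreatest (M.reward '' policies S A) M.optReward :=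
  ((isCompact_policies S A).image_of_continuousOn M.continuousOn_reward).isGreatest_sSup
    (h.image _)

theorem reward_le_optReward {q : S → A → ℝ} (hq : q ∈ policies S A) :
    M.reward q ≤ M.optReward :=
  (isGreatest_optReward ⟨q, hq⟩).2 (mem_image_of_mem _ hq)

theorem optPolicies_nonempty (h : (policies S A).Nonempty) : M.optPolicies.Nonempty := by
  obtain ⟨p, hp, he⟩ := (M.isGreatest_optReward h).1
  exact ⟨p, hp, he⟩

theorem isCompact_optPolicies : IsCompact M.optPolicies := by
  have h := M.continuousOn_reward.preimage_isClosed_of_isClosed (isCompact_policies S A).isClosed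
    (isClosed_singleton (x := M.optReward))
  exact (isCompact_policies S A).of_isClosed_subset h inter_subset_left

theorem isLeast_policyDiv [Nonempty A] {ψ : (A → ℝ) → ℝ}
    (hψ : IsRegularizer ψ) (hc : ContinuousOn ψ (stdSimplex ℝ A)) {π₀ : S → A → ℝ}
    (hπ₀ : π₀ ∈ policiesInt S A) :
    IsLeast ((fun p => M.policyDiv ψ p π₀) '' M.optPolicies)
      (sInf ((fun p => M.policyDiv ψ p π₀) '' M.optPolicies)) :=
  (isCompact_optPolicies.image_of_continuousOn
    ((M.continuousOn_policyDiv_left hψ hc hπ₀).mono fun _ hp => hp.1)).isLeast_sInf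
    ((optPolicies_nonempty ⟨π₀, policiesInt_subset_policies S A hπ₀⟩).image _)

theorem IsFlow.mul_gap_le [Nonempty A] (hM : M.Exploration) {ψ : (A → ℝ) → ℝ}
    (hψ : IsRegularizer ψ) {π₀ : S → A → ℝ} {T : EReal} {π : ℝ → S → A → ℝ}
    (h : M.IsFlow ψ π₀ T π) {t : ℝ} (ht : t ∈ timeInterval T) :
    t * (M.optReward - M.reward (π t)) ≤
      sInf ((fun p => M.policyDiv ψ p π₀) '' M.optPolicies) - M.policyDiv ψ (π t) π₀ := by
  have hne := (optPolicies_nonempty (M := M)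
    ⟨π t, policiesInt_subset_policies S A (h.mem t ht)⟩).image (fun p => M.policyDiv ψ p π₀)
  rw [le_sub_iff_add_le]
  refine le_csInf hne ?_
  rintro _ ⟨p, hp, rfl⟩
  have h1 := h.policyDiv_sub_le hM hψ hp.1 ht
  rw [hp.2] at h1
  simp only
  linarith

theorem IsFlow.tendsto_reward [Nonempty A] (hM : M.Exploration) {ψ : (A → ℝ) → ℝ}
    (hψ : IsRegularizer ψ) {π₀ : S → A → ℝ} (hπ₀ : π₀ ∈ policiesInt S A) {π : ℝ → S → A → ℝ}
    (h : M.IsFlow ψ π₀ ⊤ π) : Tendsto (fun t => M.reward (π t)) atTop (𝓝 M.optReward) := by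
  set c := sInf ((fun p => M.policyDiv ψ p π₀) '' M.optPolicies)
  have hlow : Tendsto (fun t : ℝ => M.optReward - c / t) atTop (𝓝 M.optReward) := by
    simpa using (tendsto_const_nhds (x := M.optReward)).sub
      (tendsto_const_nhds.div_atTop tendsto_id)
  refine tendsto_of_tendsto_of_tendsto_of_le_of_le' hlow tendsto_const_nhds ?_ ?_
  · filter_upwards [eventually_gt_atTop 0] with t ht
    have ht' : t ∈ timeInterval ⊤ := by simpa [timeInterval_top] using ht.le
    have h1 := h.mul_gap_le hM hψ ht'
    have h2 := M.policyDiv_nonneg hψ (policiesInt_subset_policies S A (h.mem t ht')) hπ₀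
    rw [sub_le_comm, le_div_iff₀ ht]
    linarith
  · filter_upwards [eventually_ge_atTop 0] with t ht
    exact reward_le_optReward (policiesInt_subset_policies S A (h.mem t
      (by simpa [timeInterval_top] using ht)))

/-! ### Implicit bias -/

variable (M) in
/-- The decision process with the initial distribution replaced by the uniform one. Every policy,
also on the boundary of the polytope, visits every state of it. -/
noncomputable def withUniformInit [Nonempty S] : FiniteMDP S A where
  P := M.P
  P_mem := M.P_mem
  γ := M.γ
  γ_nonneg := M.γ_nonneg
  γ_lt_one := M.γ_lt_one
  r := M.r
  μ := fun _ => (Fintype.card S : ℝ)⁻¹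
  μ_mem := ⟨fun _ => by positivity, by simp⟩

theorem withUniformInit_stateDist_pos [Nonempty S] {q : S → A → ℝ} (hq : q ∈ policies S A)
    (s : S) : 0 < M.withUniformInit.stateDist q s := by
  refine lt_of_lt_of_le (mul_pos M.one_sub_γ_pos ?_) (M.withUniformInit.le_stateDist hq s)
  simp only [withUniformInit]
  exact inv_pos.2 (by exact_mod_cast Fintype.card_pos)

theorem withUniformInit_exploration [Nonempty S] : M.withUniformInit.Exploration :=
  fun _ hπ s => withUniformInit_stateDist_pos (policiesInt_subset_policies S A hπ) s

/-- The gradient flow does not depend on the initial distribution, because action values do not. -/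
theorem IsFlow.withUniformInit [Nonempty S] (hM : M.Exploration) {ψ : (A → ℝ) → ℝ}
    {π₀ : S → A → ℝ} {T : EReal} {π : ℝ → S → A → ℝ}
    (h : M.IsFlow ψ π₀ T π) : M.withUniformInit.IsFlow ψ π₀ T π where
  init := h.init
  mem := h.mem
  eqn t ht := by
    obtain ⟨v, hv, hd⟩ := h.eqn t ht
    exact ⟨v, (isGradient_iff _ withUniformInit_exploration (h.mem t ht)).2
      ((isGradient_iff _ hM (h.mem t ht)).1 hv), hd⟩

theorem IsFlow.antitoneOn_policyDiv [Nonempty A] (hM : M.Exploration) {ψ : (A → ℝ) → ℝ}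
    (hψ : IsRegularizer ψ) {π₀ : S → A → ℝ} {π : ℝ → S → A → ℝ}
    (h : M.IsFlow ψ π₀ ⊤ π) {q : S → A → ℝ} (hq : q ∈ M.optPolicies) :
    AntitoneOn (fun t => M.policyDiv ψ q (π t)) (Ici 0) := by
  have hd := fun t (ht : t ∈ timeInterval ⊤) => h.hasDerivWithinAt_policyDiv hM hψ hq.1 ht
  have hmem := h.mem
  rw [timeInterval_top] at hd hmem
  refine antitoneOn_of_hasDerivWithinAt_nonpos (convex_Ici 0)
    (fun t ht => (hd t ht).continuousWithinAt)
    (fun t ht => (hd t (interior_subset ht)).mono interior_subset) fun t ht => ?_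
  have := reward_le_optReward (M := M)
    (policiesInt_subset_policies S A (hmem t (interior_subset ht)))
  rw [hq.2]
  linarith

theorem IsFlow.eventually_mem {ψ : (A → ℝ) → ℝ} {π₀ : S → A → ℝ} {π : ℝ → S → A → ℝ}
    (h : M.IsFlow ψ π₀ ⊤ π) : ∀ᶠ t in atTop, π t ∈ policiesInt S A := by
  filter_upwards [eventually_ge_atTop 0] with t ht
  exact h.mem t (by simpa [timeInterval_top] using ht)

/-- A global solution converges in every state if every policy visits every state: it is
Fejér monotone with respect to its cluster points. -/
theorem IsFlow.exists_tendsto_of_stateDist_pos [Nonempty A] (hM : M.Exploration)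
    (hpos : ∀ q ∈ policies S A, ∀ s, 0 < M.stateDist q s) {ψ : (A → ℝ) → ℝ}
    (hψ : IsRegularizer ψ) (hc : ContinuousOn ψ (stdSimplex ℝ A)) {π₀ : S → A → ℝ}
    (hπ₀ : π₀ ∈ policiesInt S A) {π : ℝ → S → A → ℝ} (h : M.IsFlow ψ π₀ ⊤ π) :
    ∃ q ∈ policies S A, Tendsto π atTop (𝓝 q) := by
  have hev : ∀ᶠ t in atTop, π t ∈ policies S A :=
    h.eventually_mem.mono fun t ht => policiesInt_subset_policies S A ht
  obtain ⟨q, hq, hcl⟩ := (isCompact_policies S A).exists_mapClusterPt_of_frequently hev.frequently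
  -- a statement near `q` within a set that contains the flow holds at arbitrarily late times
  have hfreq : ∀ {s : Set (S → A → ℝ)} {P : (S → A → ℝ) → Prop}, (∀ᶠ t in atTop, π t ∈ s) →
      (∀ᶠ p in 𝓝[s] q, P p) → ∃ᶠ t in atTop, P (π t) := fun hs hP =>
    ((hcl.frequently (eventually_nhdsWithin_iff.1 hP)).and_eventually hs).mono
      fun t ht => ht.1 ht.2
  have hopt : q ∈ M.optPolicies := by
    refine ⟨hq, le_antisymm (reward_le_optReward hq) (le_of_forall_lt fun c hlt => ?_)⟩
    by_contra hle
    obtain ⟨b, hb1, hb2⟩ := exists_between (lt_of_le_of_lt (not_lt.1 hle) hlt)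
    have h1 := hfreq hev ((M.continuousOn_reward q hq).eventually (gt_mem_nhds hb1))
    obtain ⟨t, ht1, ht2⟩ := (h1.and_eventually
      ((h.tendsto_reward hM hψ hπ₀).eventually (lt_mem_nhds hb2))).exists
    exact lt_asymm ht1 ht2
  refine ⟨q, hq, ?_⟩
  have hdiv : Tendsto (fun t => M.policyDiv ψ q (π t)) atTop (𝓝 0) := by
    refine tendsto_order.2 ⟨fun a ha => ?_, fun a ha => ?_⟩
    · filter_upwards [h.eventually_mem] with t ht
      exact ha.trans_le (M.policyDiv_nonneg hψ hq ht)
    · obtain ⟨t₀, ht₀, ht₀'⟩ := ((hfreq h.eventually_mem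
        ((M.tendsto_policyDiv_zero hψ hc hq).eventually (gt_mem_nhds ha))).and_eventually
          (eventually_ge_atTop 0)).exists
      filter_upwards [eventually_ge_atTop t₀] with t ht
      exact (h.antitoneOn_policyDiv hM hψ hopt ht₀' (ht₀'.trans ht) ht).trans_lt ht₀
  exact tendsto_pi_nhds.2 fun s =>
    M.tendsto_apply_of_tendsto_policyDiv_zero hψ hc hq h.eventually_mem hdiv (hpos q hq s)

theorem IsFlow.implicit_bias [Nonempty S] [Nonempty A] (hM : M.Exploration) {ψ : (A → ℝ) → ℝ}
    (hψ : IsRegularizer ψ) (hc : ContinuousOn ψ (stdSimplex ℝ A)) {π₀ : S → A → ℝ}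
    (hπ₀ : π₀ ∈ policiesInt S A) {π : ℝ → S → A → ℝ} (h : M.IsFlow ψ π₀ ⊤ π) :
    ∃ πstar ∈ M.optPolicies,
      Tendsto π atTop (𝓝 πstar) ∧
      IsMinOn (fun p => M.policyDiv ψ p π₀) M.optPolicies πstar ∧
      ∀ p ∈ M.optPolicies, IsMinOn (fun q => M.policyDiv ψ q π₀) M.optPolicies p →
        ∀ s, 0 < M.stateDist πstar s → p s = πstar s := by
  -- the uniform initial distribution yields convergence also in states that the limit avoids
  obtain ⟨q, hq, hlim⟩ := (h.withUniformInit hM).exists_tendsto_of_stateDist_pos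
    withUniformInit_exploration (fun q hq s => withUniformInit_stateDist_pos hq s) hψ hc hπ₀
  have hlim' : Tendsto π atTop (𝓝[policiesInt S A] q) :=
    tendsto_nhdsWithin_iff.2 ⟨hlim, h.eventually_mem⟩
  have hopt : q ∈ M.optPolicies := ⟨hq, tendsto_nhds_unique
    ((M.continuousOn_reward q hq).tendsto.comp (hlim'.mono_right
      (nhdsWithin_mono q (policiesInt_subset_policies S A)))) (h.tendsto_reward hM hψ hπ₀)⟩
  have hdiv : Tendsto (fun t => M.policyDiv ψ q (π t)) atTop (𝓝 0) :=
    (M.tendsto_policyDiv_zero hψ hc hq).comp hlim'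
  have hdiff : ∀ p ∈ M.optPolicies, ∀ᶠ t in atTop, M.policyDiv ψ p (π t) =
      M.policyDiv ψ p π₀ - M.policyDiv ψ q π₀ + M.policyDiv ψ q (π t) := by
    intro p hp
    filter_upwards [eventually_ge_atTop 0] with t ht
    have ht' : t ∈ timeInterval ⊤ := by simpa [timeInterval_top] using ht
    have h1 := h.regularized_reward_eq hM hψ hp.1 ht'
    have h2 := h.regularized_reward_eq hM hψ hq ht'
    rw [hp.2] at h1
    rw [hopt.2] at h2
    linarith
  have hmin : IsMinOn (fun p => M.policyDiv ψ p π₀) M.optPolicies q := by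
    refine isMinOn_iff.2 fun p hp => sub_nonneg.1 ?_
    have h1 := (hdiv.const_add (M.policyDiv ψ p π₀ - M.policyDiv ψ q π₀)).congr'
      ((hdiff p hp).mono fun t ht => ht.symm)
    rw [add_zero] at h1
    exact ge_of_tendsto h1 (h.eventually_mem.mono fun t ht => M.policyDiv_nonneg hψ hp.1 ht)
  refine ⟨q, hopt, hlim, hmin, fun p hp hpmin => ?_⟩
  have heq : M.policyDiv ψ p π₀ = M.policyDiv ψ q π₀ :=
    le_antisymm (isMinOn_iff.1 hpmin q hopt) (isMinOn_iff.1 hmin p hp)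
  have hdivp : Tendsto (fun t => M.policyDiv ψ p (π t)) atTop (𝓝 0) := by
    refine hdiv.congr' ((hdiff p hp).mono fun t ht => ?_)
    simp only [ht, heq, sub_self, zero_add]
  have hpq : ∀ s, 0 < M.stateDist p s → p s = q s := fun s hs =>
    tendsto_nhds_unique
      (M.tendsto_apply_of_tendsto_policyDiv_zero hψ hc hp.1 h.eventually_mem hdivp hs)
      (tendsto_pi_nhds.1 hlim s)
  intro s hs
  exact hpq s (by rwa [M.stateDist_eq_of_eq_on_support hp.1 hq hpq])

end FiniteMDP

/-! ### Local existence of the gradient flow -/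

namespace FiniteMDP

variable {S A : Type*} [Fintype A]

open Classical in
/-- The dual coordinates of a policy: the gradient of the extended regularizer in every state. -/
noncomputable def dualCoord (ψ : (A → ℝ) → ℝ) (π : S → A → ℝ) (s : S) (a : A) : ℝ :=
  fderiv ℝ (regExt ψ) (π s) fun b => if a = b then 1 else 0

theorem sum_mul_dualCoord (ψ : (A → ℝ) → ℝ) (π : S → A → ℝ) (s : S) (w : A → ℝ) :
    ∑ a, w a * dualCoord ψ π s a = fderiv ℝ (regExt ψ) (π s) w := by
  classical
  have h := (fderiv ℝ (regExt ψ) (π s)).toLinearMap.pi_apply_eq_sum_univ w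
  simp only [ContinuousLinearMap.coe_coe, smul_eq_mul] at h
  rw [h]
  exact Finset.sum_congr rfl fun a _ => by rw [dualCoord]

variable [Fintype S] [Nonempty A] {ψ : (A → ℝ) → ℝ}

theorem contDiffAt_dualCoord (hψ : IsRegularizer ψ) {π : S → A → ℝ}
    (hπ : ∀ s, π s ∈ regDomain A) : ContDiffAt ℝ 1 (dualCoord ψ) π := by
  refine contDiffAt_pi.2 fun s => contDiffAt_pi.2 fun a => ?_
  refine ContDiffAt.clm_apply ?_ contDiffAt_const
  exact (hψ.contDiffAt_fderiv_regExt (hπ s)).comp π (contDiff_apply ℝ (A → ℝ) s).contDiffAt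

theorem sum_mul_fderiv_dualCoord (hψ : IsRegularizer ψ) {π : S → A → ℝ}
    (hπ : ∀ s, π s ∈ regDomain A) (u : S → A → ℝ) (s : S) (w : A → ℝ) :
    ∑ a, w a * fderiv ℝ (dualCoord ψ) π u s a =
      fderiv ℝ (fderiv ℝ (regExt ψ)) (π s) (u s) w := by
  have h1 := ((contDiffAt_dualCoord hψ hπ).differentiableAt (by norm_num)).hasFDerivAt
  have h2 : HasFDerivAt (fun π => ∑ a, w a * dualCoord ψ π s a) _ π :=
    HasFDerivAt.fun_sum fun a (_ : a ∈ Finset.univ) =>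
      (hasFDerivAt_pi'.1 (hasFDerivAt_pi'.1 h1 s) a).const_mul (w a)
  have h3 : HasFDerivAt (fun π : S → A → ℝ => fderiv ℝ (regExt ψ) (π s) w) _ π :=
    ((hψ.differentiableAt_fderiv_regExt (hπ s)).hasFDerivAt.comp π
      (ContinuousLinearMap.proj (R := ℝ) (φ := fun _ => A → ℝ) s).hasFDerivAt).clm_apply
        (hasFDerivAt_const w π)
  simp only [sum_mul_dualCoord] at h2
  have h4 := congrArg (fun L : (S → A → ℝ) →L[ℝ] ℝ => L u) (h2.unique h3)
  simpa using h4

theorem injective_fderiv_dualCoord (hψ : IsRegularizer ψ) {π : S → A → ℝ}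
    (hπ : π ∈ policiesInt S A) :
    Function.Injective (fderiv ℝ (dualCoord ψ) π) := by
  refine (injective_iff_map_eq_zero _).2 fun u hu => funext fun s => ?_
  refine hψ.eq_zero_of_fderiv_fderiv_regExt_eq_zero (hπ s) (ContinuousLinearMap.ext fun w => ?_)
  rw [← sum_mul_fderiv_dualCoord hψ (fun s => simplexInt_subset_regDomain (hπ s)), hu]
  simp

/-- In dual coordinates the gradient flow is the ordinary differential equation that moves along the
action values, centered so as to preserve the normalization of the policies. Its right-hand side is
continuously differentiable, although the gradient itself is only continuous. -/
theorem exists_isFlow {M : FiniteMDP S A} (hM : M.Exploration) (hψ : IsRegularizer ψ)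
    {π₀ : S → A → ℝ} (hπ₀ : π₀ ∈ policiesInt S A) :
    ∃ T : EReal, 0 < T ∧ ∃ π, M.IsFlow ψ π₀ T π := by
  have hdom₀ : ∀ s, π₀ s ∈ regDomain A := fun s => simplexInt_subset_regDomain (hπ₀ s)
  have hn : (Fintype.card A : ℝ) ≠ 0 := by simp
  have hΦ := contDiffAt_dualCoord hψ hdom₀
  let e : (S → A → ℝ) ≃L[ℝ] (S → A → ℝ) := (LinearEquiv.ofInjectiveEndo
    (fderiv ℝ (dualCoord ψ) π₀).toLinearMap
      (injective_fderiv_dualCoord hψ hπ₀)).toContinuousLinearEquiv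
  have he : HasFDerivAt (dualCoord ψ) (e : (S → A → ℝ) →L[ℝ] (S → A → ℝ)) π₀ :=
    (hΦ.differentiableAt (by norm_num)).hasFDerivAt
  set H := hΦ.localInverse he one_ne_zero with hH
  have hH0 : H (dualCoord ψ π₀) = π₀ := hΦ.localInverse_apply_image he one_ne_zero
  have hHd : ContDiffAt ℝ 1 H (dualCoord ψ π₀) := hΦ.to_localInverse he one_ne_zero
  have hright : ∀ᶠ θ in 𝓝 (dualCoord ψ π₀), dualCoord ψ (H θ) = θ :=
    (hΦ.hasStrictFDerivAt' he one_ne_zero).eventually_right_inverse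
  let F : (S → A → ℝ) → S → A → ℝ := fun θ s a =>
    M.qFn (H θ) s a - (∑ b, M.qFn (H θ) s b) / Fintype.card A
  have hF : ContDiffAt ℝ 1 F (dualCoord ψ π₀) := by
    have hq : ContDiffAt ℝ 1 (fun θ => M.qFn (H θ)) (dualCoord ψ π₀) := by
      have h := M.contDiffAt_qFn (policiesInt_subset_policies S A hπ₀)
      rw [← hH0] at h
      exact h.comp _ hHd
    have hq' : ∀ s a, ContDiffAt ℝ 1 (fun θ => M.qFn (H θ) s a) (dualCoord ψ π₀) := fun s =>
      contDiffAt_pi.1 (contDiffAt_pi.1 hq s)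
    exact contDiffAt_pi.2 fun s => contDiffAt_pi.2 fun a =>
      (hq' s a).sub ((ContDiffAt.sum fun b _ => hq' s b).div_const _)
  have hFsum : ∀ θ s, ∑ a, F θ s a = 0 := by
    intro θ s
    simp only [F, Finset.sum_sub_distrib, Finset.sum_const, Finset.card_univ, nsmul_eq_mul]
    field_simp
    ring
  obtain ⟨α, hα0, ε, hε, hα⟩ :=
    hF.exists_forall_mem_closedBall_exists_eq_forall_mem_Ioo_hasDerivAt₀ 0
  simp only [zero_sub, zero_add] at hα
  have hgood : ∀ᶠ θ in 𝓝 (dualCoord ψ π₀), DifferentiableAt ℝ H θ ∧ dualCoord ψ (H θ) = θ ∧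
      (∀ s, H θ s ∈ regDomain A) ∧ ∀ s a, 0 < H θ s a := by
    have hHc : Tendsto H (𝓝 (dualCoord ψ π₀)) (𝓝 π₀) := by
      simpa [hH0] using hHd.continuousAt.tendsto
    refine ((hHd.eventually (by simp)).mono fun θ hθ =>
      hθ.differentiableAt (by norm_num)).and (hright.and (.and ?_ ?_))
    · exact eventually_all.2 fun s => (tendsto_pi_nhds.1 hHc s).eventually
        (isOpen_regDomain.mem_nhds (hdom₀ s))
    · exact eventually_all.2 fun s => eventually_all.2 fun a =>
        (tendsto_pi_nhds.1 (tendsto_pi_nhds.1 hHc s) a).eventually (lt_mem_nhds ((hπ₀ s).1 a))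
  have hαc : Tendsto α (𝓝 0) (𝓝 (dualCoord ψ π₀)) := by
    have := (hα 0 ⟨neg_lt_zero.2 hε, hε⟩).continuousAt.tendsto
    rwa [hα0] at this
  obtain ⟨δ, hδ, hball⟩ := Metric.eventually_nhds_iff_ball.1
    ((hαc.eventually hgood).and (Ioo_mem_nhds (neg_lt_zero.2 hε) hε))
  rw [Real.ball_eq_Ioo, zero_sub, zero_add] at hball
  -- the sum of the dual coordinates in a state measures the defect of the normalization
  have hsum : ∀ t ∈ Ioo (-δ) δ, ∀ s, ∑ a, H (α t) s a = 1 := by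
    intro t ht s
    have hd : ∀ τ ∈ Ioo (-δ) δ, HasDerivAt (fun τ => ∑ a, α τ s a) 0 τ := by
      intro τ hτ
      have h := hasDerivAt_pi.1 (hα τ (hball τ hτ).2) s
      exact (HasDerivAt.fun_sum fun a (_ : a ∈ Finset.univ) => hasDerivAt_pi.1 h a).congr_deriv
        (hFsum (α τ) s)
    have hc := isOpen_Ioo.is_const_of_deriv_eq_zero isPreconnected_Ioo
      (fun τ hτ => (hd τ hτ).differentiableAt.differentiableWithinAt)
      (fun τ hτ => (hd τ hτ).deriv) ht (show (0 : ℝ) ∈ Ioo (-δ) δ from ⟨neg_lt_zero.2 hδ, hδ⟩)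
    have hval : ∀ π : S → A → ℝ, (∀ s, π s ∈ regDomain A) →
        ∑ a, dualCoord ψ π s a = Fintype.card A * (∑ a, π s a - 1) := fun π hπ => by
      rw [← hψ.fderiv_regExt_one (hπ s), ← sum_mul_dualCoord]
      simp
    obtain ⟨-, h2, h3, -⟩ := (hball t ht).1
    have h4 := hval _ h3
    simp only [hα0] at hc
    rw [h2, hc, hval _ hdom₀, (hπ₀ s).2] at h4
    have h5 : (Fintype.card A : ℝ) * (∑ a, H (α t) s a - 1) = 0 := by linarith
    linarith [(mul_eq_zero.1 h5).resolve_left hn]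
  have hsub : timeInterval (δ : EReal) ⊆ Ioo (-δ) δ := fun t ht =>
    ⟨by linarith [ht.1], EReal.coe_lt_coe_iff.1 ht.2⟩
  refine ⟨(δ : EReal), EReal.coe_pos.2 hδ, fun t => H (α t), ?_, fun t ht s =>
    ⟨(hball t (hsub ht)).1.2.2.2 s, hsum t (hsub ht) s⟩, fun t ht => ?_⟩
  · simp only [hα0, hH0]
  · obtain ⟨hHt, -, hdom, hpos⟩ := (hball t (hsub ht)).1
    have hπt : H (α t) ∈ policiesInt S A := fun s => ⟨hpos s, hsum t (hsub ht) s⟩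
    have hαt := hα t (hball t (hsub ht)).2
    have hd := hHt.hasFDerivAt.comp_hasDerivAt t hαt
    set v := fderiv ℝ H (α t) (F (α t)) with hv
    have hdual : fderiv ℝ (dualCoord ψ) (H (α t)) v = F (α t) := by
      have h1 := ((contDiffAt_dualCoord hψ hdom).differentiableAt
        (by norm_num)).hasFDerivAt.comp_hasDerivAt t hd
      refine h1.unique (hαt.congr_of_eventuallyEq ?_)
      filter_upwards [isOpen_Ioo.mem_nhds (hsub ht)] with τ hτ using (hball τ hτ).1.2.1
    have hhess := sum_mul_fderiv_dualCoord hψ hdom v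
    simp only [hdual] at hhess
    have hvt : v ∈ policyTangent S A := by
      intro s
      have h1 := hhess s 1
      simp only [Pi.one_apply, one_mul, hFsum, hψ.fderiv_fderiv_regExt_one (hdom s)] at h1
      exact (mul_eq_zero.1 h1.symm).resolve_left hn
    refine ⟨v, (M.isGradient_iff hM hπt).2 ⟨hvt, fun s w hw => ?_⟩, hd.hasDerivWithinAt⟩
    have hw' : ∑ a, w a = 0 := hw
    rw [hψ.hessForm_eq (hπt s) (hvt s) hw, hψ.fderiv_fderiv_regExt_comm (hdom s), ← hhess]
    simp only [F, mul_sub, Finset.sum_sub_distrib, ← Finset.sum_mul, hw', zero_mul, sub_zero]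

end FiniteMDP

theorem mainTheorem9 {S A : Type*} [Fintype S] [Fintype A] (M : FiniteMDP S A)
    (hM : M.Exploration) (ψ : (A → ℝ) → ℝ) (hψ : IsRegularizer ψ)
    (π₀ : S → A → ℝ) (hπ₀ : π₀ ∈ policiesInt S A) :
    -- well-posedness: local existence, and any two solutions agree as long as both exist
    ((∃ T : EReal, 0 < T ∧ ∃ π, M.IsFlow ψ π₀ T π) ∧
      ∀ (T₁ T₂ : EReal) (π₁ π₂ : ℝ → S → A → ℝ), M.IsFlow ψ π₀ T₁ π₁ → M.IsFlow ψ π₀ T₂ π₂ →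
        ∀ t ∈ timeInterval T₁ ∩ timeInterval T₂, π₁ t = π₂ t) ∧
    -- central path property: the unique maximizer at time t is the flow at time t
    (∀ (T : EReal) (π : ℝ → S → A → ℝ), M.IsFlow ψ π₀ T π → ∀ t ∈ timeInterval T, 0 < t →
      {p ∈ policies S A | IsMaxOn (fun q => M.reward q - t⁻¹ * M.policyDiv ψ q π₀)
        (policies S A) p} = {π t}) ∧
    -- sublinear convergence; the optimal reward is attained
    (IsGreatest (M.reward '' policies S A) M.optReward ∧
      ∀ (T : EReal) (π : ℝ → S → A → ℝ), M.IsFlow ψ π₀ T π → ∀ t ∈ timeInterval T, 0 < t →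
        0 ≤ M.optReward - M.reward (π t) ∧
        M.optReward - M.reward (π t) ≤
          (sInf ((fun p => M.policyDiv ψ p π₀) '' M.optPolicies) - M.policyDiv ψ (π t) π₀) / t ∧
        (sInf ((fun p => M.policyDiv ψ p π₀) '' M.optPolicies) - M.policyDiv ψ (π t) π₀) / t ≤
          sInf ((fun p => M.policyDiv ψ p π₀) '' M.optPolicies) / t) ∧
    -- for continuous regularizers: the infimum above is a minimum, and the implicit bias
    (ContinuousOn ψ (stdSimplex ℝ A) →
      IsLeast ((fun p => M.policyDiv ψ p π₀) '' M.optPolicies)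
        (sInf ((fun p => M.policyDiv ψ p π₀) '' M.optPolicies)) ∧
      ∀ π : ℝ → S → A → ℝ, M.IsFlow ψ π₀ ⊤ π →
        ∃ πstar ∈ M.optPolicies,
          Tendsto π atTop (𝓝 πstar) ∧
          IsMinOn (fun p => M.policyDiv ψ p π₀) M.optPolicies πstar ∧
          ∀ p ∈ M.optPolicies, IsMinOn (fun q => M.policyDiv ψ q π₀) M.optPolicies p →
            ∀ s, 0 < M.stateDist πstar s → p s = πstar s) := by
  -- a decision process has a state and, in view of `π₀`, an action
  have hS : Nonempty S := by
    by_contra h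
    rw [not_nonempty_iff] at h
    simpa using M.μ_mem.2
  have hA : Nonempty A := by
    by_contra h
    rw [not_nonempty_iff] at h
    simpa using (hπ₀ hS.some).2
  refine ⟨⟨FiniteMDP.exists_isFlow hM hψ hπ₀, fun T₁ T₂ π₁ π₂ h₁ h₂ t ht => h₁.unique hM hψ h₂ ht⟩,
    fun T π h t ht ht0 => h.maximizers_eq hM hψ ht ht0,
    ⟨FiniteMDP.isGreatest_optReward ⟨π₀, policiesInt_subset_policies S A hπ₀⟩,
      fun T π h t ht ht0 => ?_⟩,
    fun hc => ⟨FiniteMDP.isLeast_policyDiv hψ hc hπ₀, fun π h => h.implicit_bias hM hψ hc hπ₀⟩⟩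
  have hmem := policiesInt_subset_policies S A (h.mem t ht)
  refine ⟨sub_nonneg.2 (FiniteMDP.reward_le_optReward hmem), ?_, ?_⟩
  · rw [le_div_iff₀ ht0, mul_comm]
    exact h.mul_gap_le hM hψ ht
  · exact div_le_div_of_nonneg_right (sub_le_self _ (M.policyDiv_nonneg hψ hmem hπ₀)) ht0.le
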